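/- Let $p,q:[0,\infty)\to\mathbb R$ be continuously differentiable and put $$J=\begin{bmatrix}0&1\\-1&0\end{bmatrix},\qquad \mathcal V(x)=\begin{bmatrix}p(x)&q(x)\\q(x)&-p(x)\end{bmatrix}.$$ Consider the dynamical Dirac system $$\mathrm i Y_t+JY_x+\mathcal V(x)Y=0\quad(x>0,\ t>0),\qquad Y(x,0)=0\ (x\ge 0),\quad Y_1(0,t)=f(t)\ (t\ge0),$$ where $Y=\begin{bmatrix}Y_1\\Y_2\end{bmatrix}$ is a classical solution (continuous for $x,t\ge 0$, continuously differentiable for $x,t>0$) and the boundary control $f$ is any complex-valued continuously differentiable function on $[0,\infty)$ with $f(0)=f'(0)=0$. The response function of the system is the continuous function $r:[0,\infty)\to\mathbb C$ such that for all such $f$ and the corresponding solution $Y$ $$Y_2(0,t)=\mathrm i f(t)+\int_0^t r(t-s)f(s)\,ds\qquad(t\ge0).$$ Assume that the response function $r$ of the system admits the representation $$r(t)=-2\mathrm i\,\vartheta_2^*\mathrm e^{-\mathrm i t\alpha}\vartheta_1\qquad(t\ge 0),$$ where the $n\times n$ complex matrix $\alpha$ and the column vectors $\vartheta_1,\vartheta_2\in\mathbb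 C^n$ satisfy $$\alpha-\alpha^*=-\mathrm i(\vartheta_1+\vartheta_2)(\vartheta_1+\vartheta_2)^*.$$ Put $$A=\alpha+\mathrm i\,\vartheta_1(\vartheta_1+\vartheta_2)^*,\quad \Lambda(t)=\begin{bmatrix}\mathrm e^{-\mathrm i tA}\vartheta_1&\mathrm e^{\mathrm i tA}\vartheta_2\end{bmatrix},\quad S(x)=I_n+\int_0^x\Lambda(t)\Lambda(t)^*\,dt .$$ Then for every $x\ge0$ the matrix $S(x)$ is invertible and the potential $\mathcal V$ of the system is given by $$p(x)=-\Re v(x),\qquad q(x)=\Im v(x),\qquad v(x)=-2\mathrm i\,\vartheta_1^*\mathrm e^{\mathrm i xA^*}S(x)^{-1}\mathrm e^{\mathrm i xA}\vartheta_2 .$$ -/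

import Mathlib

open Set Matrix

noncomputable section

namespace DynDirac

/-- The matrix `J` of the dynamical Dirac system. -/
def J : Matrix (Fin 2) (Fin 2) ℂ := !![0, 1; -1, 0]

/-- The matrix potential built from the real-valued functions `p` and `q`. -/
def potential (p q : ℝ → ℝ) (x : ℝ) : Matrix (Fin 2) (Fin 2) ℂ :=
  !![(p x : ℂ), (q x : ℂ); (q x : ℂ), -(p x : ℂ)]

/-- Admissible boundary controls: `f` is continuously differentiable and vanishes for `t ≤ 0`.
This amounts to a continuously differentiable `f` on `[0, ∞)` with `f 0 = f' 0 = 0`,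
extended by zero. -/
structure IsControl (f : ℝ → ℂ) : Prop where
  contDiff : ContDiff ℝ 1 f
  eq_zero : ∀ t ≤ 0, f t = 0

/-- `Y` is a classical solution in the quarter-plane `x > 0`, `t > 0` of the dynamical Dirac system
`i Y_t + J Y_x + V Y = 0` with `Y(x, 0) = 0` for `x ≥ 0` and `Y₁(0, t) = f(t)` for `t ≥ 0`:
it is continuous up to the boundary and continuously differentiable inside. -/
structure IsSolution (p q : ℝ → ℝ) (f : ℝ → ℂ) (Y : ℝ → ℝ → Fin 2 → ℂ) : Prop where
  continuousOn : ContinuousOn (fun z : ℝ × ℝ => Y z.1 z.2) (Ici 0 ×ˢ Ici 0)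
  contDiffOn : ContDiffOn ℝ 1 (fun z : ℝ × ℝ => Y z.1 z.2) (Ioi 0 ×ˢ Ioi 0)
  equation : ∀ x > 0, ∀ t > 0,
    Complex.I • deriv (fun τ => Y x τ) t + J *ᵥ deriv (fun ξ => Y ξ t) x
      + potential p q x *ᵥ Y x t = 0
  initial : ∀ x ≥ 0, Y x 0 = 0
  boundary : ∀ t ≥ 0, Y 0 t 0 = f t

/-- `r` is the response function of the system with potential given by `p`, `q`: the response
operator `Y₁(0, ·) ↦ Y₂(0, ·)` is `f ↦ i f + r * f`. -/
structure IsResponseFunction (p q : ℝ → ℝ) (r : ℝ → ℂ) : Prop where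
  continuousOn : ContinuousOn r (Ici 0)
  response : ∀ f, IsControl f → ∀ Y, IsSolution p q f Y → ∀ t ≥ 0,
    Y 0 t 1 = Complex.I * f t + ∫ s in (0 : ℝ)..t, r (t - s) * f s

variable {n : ℕ}

/-- `A = α + i ϑ₁ (ϑ₁ + ϑ₂)*`. -/
def matA (α : Matrix (Fin n) (Fin n) ℂ) (θ₁ θ₂ : Fin n → ℂ) : Matrix (Fin n) (Fin n) ℂ :=
  α + Complex.I • vecMulVec θ₁ (star (θ₁ + θ₂))

/-- The `n × 2` matrix `Λ(t)` with columns `exp(-i t A) ϑ₁` and `exp(i t A) ϑ₂`. -/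
def matΛ (A : Matrix (Fin n) (Fin n) ℂ) (θ₁ θ₂ : Fin n → ℂ) (t : ℝ) : Matrix (Fin n) (Fin 2) ℂ :=
  (Matrix.of ![NormedSpace.exp (-(Complex.I * (t : ℂ)) • A) *ᵥ θ₁,
    NormedSpace.exp ((Complex.I * (t : ℂ)) • A) *ᵥ θ₂])ᵀ

/-- `S(x) = I + ∫₀ˣ Λ(t) Λ(t)* dt`, the integral being taken entrywise. -/
def matS (A : Matrix (Fin n) (Fin n) ℂ) (θ₁ θ₂ : Fin n → ℂ) (x : ℝ) : Matrix (Fin n) (Fin n) ℂ :=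
  1 + Matrix.of fun i j =>
    ∫ t in (0 : ℝ)..x, (matΛ A θ₁ θ₂ t * (matΛ A θ₁ θ₂ t)ᴴ) i j

/-- `v(x) = -2i ϑ₁* exp(i x A*) S(x)⁻¹ exp(i x A) ϑ₂`. -/
def explicitV (A : Matrix (Fin n) (Fin n) ℂ) (θ₁ θ₂ : Fin n → ℂ) (x : ℝ) : ℂ :=
  -2 * Complex.I * (star θ₁ ⬝ᵥ
    ((NormedSpace.exp ((Complex.I * (x : ℂ)) • Aᴴ) * (matS A θ₁ θ₂ x)⁻¹ *
      NormedSpace.exp ((Complex.I * (x : ℂ)) • A)) *ᵥ θ₂))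

end DynDirac

end

/-! Write `Y = (a + b, i (a - b))` and `k = q + i p`. The system splits into a wave `a` moving right
and a wave `b` moving left: `a_x = k b` at fixed `τ = t - x`, and `b_x = conj(k) a` at fixed `t +
x`. For the impulse `a(0, ·) = δ`, the regular parts `P`, `Q` of `a`, `b` solve a Goursat problem on
the quarter-plane (`exists_isImpulseResponse`), and the left-moving part carries the potential on
the wave front: `k x = -2 conj (Q x 0)`.

The boundary trace `Q 0 ·` is read off from the response function. Integrating the impulse response
three times gives a classical solution, so the response identity applies to it and becomes a
convolution equation `b = ρ * (a + b)` at `x = 0` with `ρ(t) = ϑ₂* exp(-itα) ϑ₁`. Realising `ρ` by a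
linear state equation turns this feedback into a rank-one change of generator, whence `Q 0 τ = ϑ₂*
exp(-iτM) ϑ₁` with `M = α + i ϑ₁ ϑ₂* = A - i ϑ₁ ϑ₁*` (`right_boundary`).

Eliminating `k` through the front relation leaves a closed nonlinear Volterra system for `(P, Q)`,
in which the only datum is `Q 0 ·`. A weighted Gronwall argument shows that this datum determines `Q
x 0` (`IsImpulseKernel.unique`). An explicit solution with the same datum is `Q = ϑ₂* exp(-ixA*)
S(x)⁻¹ exp(-ixA) exp(-iτM) ϑ₁`; it is verified by means of the Lyapunov identity for `S`
(`lyapunov_matS`, `hasDerivAt_dressed`). Comparing the two at `τ = 0` gives `k`, and `v = i k`. -/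

noncomputable section

namespace DynDirac

open scoped ComplexConjugate

/-! ### Existence of the impulse response by a weighted contraction. -/

section

open BoundedContinuousFunction

/-- The backward part of the characteristic integral equations for the impulse response. -/
def goursatQ (k : ℝ → ℂ) (P : ℝ → ℝ → ℂ) (x τ : ℝ) : ℂ :=
  -conj (k (x + τ / 2)) / 2
    - ∫ η in x..(x + τ / 2), conj (k η) * P η (2 * x + τ - 2 * η)

/-- The forward part of the characteristic integral equations for the impulse response. -/
def goursatP (k : ℝ → ℂ) (P : ℝ → ℝ → ℂ) (x τ : ℝ) : ℂ :=
  ∫ ξ in (0 : ℝ)..x, k ξ * goursatQ k P ξ τ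

theorem continuous_integral_of_continuous {X : Type*} [TopologicalSpace X] {f : X → ℝ → ℂ}
    (hf : Continuous (Function.uncurry f)) {u v : X → ℝ} (hu : Continuous u) (hv : Continuous v) :
    Continuous fun z => ∫ s in (u z)..(v z), f z s := by
  have hfz : ∀ z, Continuous (f z) := fun z => hf.comp (by fun_prop : Continuous fun s => (z, s))
  have h : (fun z => ∫ s in (u z)..(v z), f z s)
      = fun z => (∫ s in (0 : ℝ)..(v z), f z s) - ∫ s in (0 : ℝ)..(u z), f z s := by
    funext z
    rw [intervalIntegral.integral_interval_sub_left ((hfz z).intervalIntegrable _ _)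
      ((hfz z).intervalIntegrable _ _)]
  rw [h]
  exact (intervalIntegral.continuous_parametric_intervalIntegral_of_continuous hf hv).sub
    (intervalIntegral.continuous_parametric_intervalIntegral_of_continuous hf hu)

theorem continuous_goursatQ {k : ℝ → ℂ} (hk : Continuous k) {P : ℝ → ℝ → ℂ}
    (hP : Continuous (Function.uncurry P)) : Continuous (Function.uncurry (goursatQ k P)) := by
  have h : Continuous fun z : ℝ × ℝ => ∫ η in z.1..(z.1 + z.2 / 2),
      conj (k η) * P η (2 * z.1 + z.2 - 2 * η) := by
    refine continuous_integral_of_continuous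
      (f := fun (z : ℝ × ℝ) η => conj (k η) * P η (2 * z.1 + z.2 - 2 * η)) ?_
      (by fun_prop) (by fun_prop)
    have := hP.comp (by fun_prop : Continuous fun w : (ℝ × ℝ) × ℝ =>
      (w.2, 2 * w.1.1 + w.1.2 - 2 * w.2))
    exact (Complex.continuous_conj.comp (hk.comp continuous_snd)).mul this
  have h' : Continuous fun z : ℝ × ℝ => -conj (k (z.1 + z.2 / 2)) / 2 := by
    have := Complex.continuous_conj.comp
      (hk.comp (by fun_prop : Continuous fun z : ℝ × ℝ => z.1 + z.2 / 2))
    exact this.neg.div_const 2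
  exact h'.sub h

theorem continuous_goursatP {k : ℝ → ℂ} (hk : Continuous k) {P : ℝ → ℝ → ℂ}
    (hP : Continuous (Function.uncurry P)) : Continuous (Function.uncurry (goursatP k P)) := by
  refine continuous_integral_of_continuous
    (f := fun (z : ℝ × ℝ) ξ => k ξ * goursatQ k P ξ z.2) ?_ continuous_const continuous_fst
  exact (hk.comp continuous_snd).mul ((continuous_goursatQ hk hP).comp
    (by fun_prop : Continuous fun w : (ℝ × ℝ) × ℝ => (w.2, w.1.2)))

/-- Rescaling `[0, y]` to the fixed compact interval `[0, 1]` makes the running supremum continuous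
in `y`; continuity is needed because the exponent of the weight is an integral of this bound. -/
theorem exists_continuous_bound {k : ℝ → ℂ} (hk : Continuous k) :
    ∃ κ : ℝ → ℝ, Continuous κ ∧ ∀ y η, 0 ≤ η → η ≤ y → ‖k η‖ ≤ κ y := by
  refine ⟨fun y => sSup ((fun s => ‖k (y * s)‖) '' Icc (0 : ℝ) 1), ?_, ?_⟩
  · refine isCompact_Icc.continuous_sSup (f := fun y s => ‖k (y * s)‖) ?_
    exact (hk.comp (by fun_prop : Continuous fun w : ℝ × ℝ => w.1 * w.2)).norm
  · intro y η h0 hy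
    have hc : Continuous fun s : ℝ => ‖k (y * s)‖ := by fun_prop
    have hb : BddAbove ((fun s => ‖k (y * s)‖) '' Icc (0 : ℝ) 1) :=
      (isCompact_Icc.image hc).bddAbove
    rcases h0.eq_or_lt with h | h
    · exact le_csSup hb ⟨0, by simp, by simp [← h]⟩
    · have hy0 : 0 < y := h.trans_le hy
      refine le_csSup hb ⟨η / y, ⟨by positivity, (div_le_one hy0).2 hy⟩, ?_⟩
      simp only
      rw [mul_div_cancel₀ _ hy0.ne']

/-- The integral inequality behind the weighted norm. -/
theorem norm_integral_le_weight {ψ : ℝ → ℝ} (hψ : Continuous ψ) {C x τ : ℝ} (hx : 0 ≤ x)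
    (hC : 0 ≤ C) {F : ℝ → ℂ}
    (hF : ∀ ξ ∈ Icc 0 x, ‖F ξ‖ ≤ C * (ψ (2 * ξ + τ) *
      Real.exp (∫ s in (0 : ℝ)..(2 * ξ + τ), ψ s))) :
    ‖∫ ξ in (0 : ℝ)..x, F ξ‖ ≤ C / 2 * Real.exp (∫ s in (0 : ℝ)..(2 * x + τ), ψ s) := by
  have hd : ∀ y, HasDerivAt (fun y => ∫ s in (0 : ℝ)..y, ψ s) (ψ y) y := fun y =>
    intervalIntegral.integral_hasDerivAt_right (hψ.intervalIntegrable _ _)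
      (hψ.stronglyMeasurableAtFilter _ _) hψ.continuousAt
  have hΨ : Continuous fun y => ∫ s in (0 : ℝ)..y, ψ s :=
    continuous_iff_continuousAt.2 fun y => (hd y).continuousAt
  have hd2 : ∀ ξ, HasDerivAt (fun ξ => C / 2 * Real.exp (∫ s in (0 : ℝ)..(2 * ξ + τ), ψ s))
      (C * (ψ (2 * ξ + τ) * Real.exp (∫ s in (0 : ℝ)..(2 * ξ + τ), ψ s))) ξ := by
    intro ξ
    have h1 : HasDerivAt (fun ξ : ℝ => 2 * ξ + τ) 2 ξ := by
      simpa using ((hasDerivAt_id ξ).const_mul 2).add_const τ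
    have h2 := (((hd (2 * ξ + τ)).comp ξ h1).exp).const_mul (C / 2)
    refine h2.congr_deriv ?_
    simp only [Function.comp]
    ring
  have hi : Continuous fun ξ => C * (ψ (2 * ξ + τ) *
      Real.exp (∫ s in (0 : ℝ)..(2 * ξ + τ), ψ s)) := by fun_prop
  refine (intervalIntegral.norm_integral_le_of_norm_le hx
    (Filter.Eventually.of_forall fun ξ hξ => hF ξ ⟨hξ.1.le, hξ.2⟩)
    (hi.intervalIntegrable _ _)).trans ?_
  rw [intervalIntegral.integral_eq_sub_of_hasDerivAt (fun ξ _ => hd2 ξ)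
    (hi.intervalIntegrable _ _)]
  have : 0 ≤ C / 2 * Real.exp (∫ s in (0 : ℝ)..(2 * 0 + τ), ψ s) := by positivity
  linarith

/-- The backward integral runs along a characteristic, on which `2η + σ` is constant, so a bound
depending only on that quantity leaves the integral; the path has length `τ / 2`. -/
theorem norm_goursatQ_sub_le {k : ℝ → ℂ} (hk : Continuous k) {P P' : ℝ → ℝ → ℂ}
    (hP : Continuous (Function.uncurry P)) (hP' : Continuous (Function.uncurry P'))
    {x τ K B : ℝ} (hx : 0 ≤ x) (hτ : 0 ≤ τ)
    (hK : ∀ η, 0 ≤ η → η ≤ 2 * x + τ → ‖k η‖ ≤ K)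
    (hB : ∀ η σ, 0 ≤ η → 0 ≤ σ → 2 * η + σ = 2 * x + τ → ‖P η σ - P' η σ‖ ≤ B) :
    ‖goursatQ k P x τ - goursatQ k P' x τ‖ ≤ K * B * (τ / 2) := by
  have hc : ∀ {P : ℝ → ℝ → ℂ}, Continuous (Function.uncurry P) →
      Continuous fun η => conj (k η) * P η (2 * x + τ - 2 * η) := fun h =>
    (Complex.continuous_conj.comp hk).mul
      (h.comp (by fun_prop : Continuous fun η : ℝ => (η, 2 * x + τ - 2 * η)))
  have h : goursatQ k P x τ - goursatQ k P' x τ = -∫ η in x..(x + τ / 2),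
      conj (k η) * (P η (2 * x + τ - 2 * η) - P' η (2 * x + τ - 2 * η)) := by
    simp only [goursatQ, mul_sub]
    rw [intervalIntegral.integral_sub ((hc hP).intervalIntegrable _ _)
      ((hc hP').intervalIntegrable _ _)]
    ring
  have hK0 : 0 ≤ K := (norm_nonneg _).trans (hK x hx (by linarith))
  rw [h, norm_neg]
  refine (intervalIntegral.norm_integral_le_of_norm_le_const (C := K * B) ?_).trans ?_
  · intro η hη
    rw [uIoc_of_le (by linarith)] at hη
    have h1 : 0 ≤ η := hx.trans hη.1.le
    have h2 := hη.2
    rw [norm_mul, RCLike.norm_conj]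
    exact mul_le_mul (hK η h1 (by linarith)) (hB η _ h1 (by linarith) (by ring))
      (norm_nonneg _) hK0
  · rw [add_sub_cancel_left, abs_of_nonneg (by linarith)]

/-- The weight is a function of `y = 2x + τ` alone, which the backward integral preserves. The
forward integral moves `y`, and `W' = ψ W` with `ψ = κ² (1 + |y|)` absorbs both factors `k` and the
path length. One factor `1/2` comes from the path length `τ / 2`, another from `dy = 2 dξ`: hence
the contraction constant `1/4`. -/
theorem exists_weight {k : ℝ → ℂ} (hk : Continuous k) :
    ∃ W : ℝ → ℝ, Continuous W ∧ (∀ y, 0 < W y) ∧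
      (∀ P P' : ℝ → ℝ → ℂ, Continuous (Function.uncurry P) → Continuous (Function.uncurry P') →
        ∀ c, 0 ≤ c →
        (∀ x τ, 0 ≤ x → 0 ≤ τ → ‖P x τ - P' x τ‖ ≤ c * W (2 * x + τ)) →
        ∀ x τ, 0 ≤ x → 0 ≤ τ →
          ‖goursatP k P x τ - goursatP k P' x τ‖ ≤ c / 4 * W (2 * x + τ)) ∧
      (∀ x τ, 0 ≤ x → 0 ≤ τ →
        ‖goursatP k (fun _ _ => 0) x τ‖ ≤ 1 / 4 * W (2 * x + τ)) := by
  obtain ⟨κ, hκ, hkκ⟩ := exists_continuous_bound hk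
  let ψ : ℝ → ℝ := fun y => κ y ^ 2 * (1 + |y|)
  have hψ : Continuous ψ := by fun_prop
  have hψ0 : ∀ y, 0 ≤ ψ y := fun y => by positivity
  let W : ℝ → ℝ := fun y => Real.exp (∫ s in (0 : ℝ)..y, ψ s)
  have hW0 : ∀ y, 0 < W y := fun y => Real.exp_pos _
  have hW1 : ∀ y, 0 ≤ y → 1 ≤ W y := fun y hy =>
    Real.one_le_exp (intervalIntegral.integral_nonneg hy fun s _ => hψ0 s)
  have hWc : Continuous W := Real.continuous_exp.comp
    (intervalIntegral.continuous_primitive (fun a b => hψ.intervalIntegrable a b) 0)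
  have hκ0 : ∀ y, 0 ≤ y → 0 ≤ κ y := fun y hy => (norm_nonneg _).trans (hkκ y y hy le_rfl)
  refine ⟨W, hWc, hW0, ?_, ?_⟩
  · intro P P' hP hP' c hc h x τ hx hτ
    have hi : ∀ {P : ℝ → ℝ → ℂ}, Continuous (Function.uncurry P) →
        Continuous fun ξ => k ξ * goursatQ k P ξ τ := fun h =>
      hk.mul ((continuous_goursatQ hk h).comp (by fun_prop : Continuous fun ξ : ℝ => (ξ, τ)))
    rw [goursatP, goursatP, ← intervalIntegral.integral_sub ((hi hP).intervalIntegrable _ _)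
      ((hi hP').intervalIntegrable _ _)]
    refine (norm_integral_le_weight hψ (C := c / 2) (τ := τ) hx (by positivity) ?_).trans_eq
      (by ring)
    intro ξ hξ
    have hy : 0 ≤ 2 * ξ + τ := by linarith [hξ.1]
    have h1 := norm_goursatQ_sub_le hk hP hP' hξ.1 hτ (hkκ (2 * ξ + τ))
      (B := c * W (2 * ξ + τ)) (fun η σ hη hσ he => he ▸ h η σ hη hσ)
    have h2 := hkκ (2 * ξ + τ) ξ hξ.1 (by linarith [hξ.1])
    rw [← mul_sub, norm_mul]
    calc ‖k ξ‖ * ‖goursatQ k P ξ τ - goursatQ k P' ξ τ‖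
        ≤ κ (2 * ξ + τ) * (κ (2 * ξ + τ) * (c * W (2 * ξ + τ)) * (τ / 2)) :=
          mul_le_mul h2 h1 (norm_nonneg _) (hκ0 _ hy)
      _ = c / 2 * (κ (2 * ξ + τ) ^ 2 * τ * W (2 * ξ + τ)) := by ring
      _ ≤ c / 2 * (κ (2 * ξ + τ) ^ 2 * (1 + |2 * ξ + τ|) * W (2 * ξ + τ)) := by
          have := (hW0 (2 * ξ + τ)).le
          have h3 : τ ≤ 1 + |2 * ξ + τ| := by rw [abs_of_nonneg hy]; linarith [hξ.1]
          gcongr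
  · intro x τ hx hτ
    refine (norm_integral_le_weight hψ (C := 1 / 2) (τ := τ) hx (by positivity) ?_).trans_eq
      (by ring)
    intro ξ hξ
    have hy : 0 ≤ 2 * ξ + τ := by linarith [hξ.1]
    have h1 := hkκ (2 * ξ + τ) ξ hξ.1 (by linarith [hξ.1])
    have h2 := hkκ (2 * ξ + τ) (ξ + τ / 2) (by linarith [hξ.1]) (by linarith [hξ.1])
    have h3 := hW1 _ hy
    have h4 : (1 : ℝ) ≤ 1 + |2 * ξ + τ| := by linarith [abs_nonneg (2 * ξ + τ)]
    simp only [goursatQ, mul_zero, intervalIntegral.integral_zero, sub_zero, norm_mul, norm_div,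
      norm_neg, RCLike.norm_conj, RCLike.norm_ofNat]
    calc ‖k ξ‖ * (‖k (ξ + τ / 2)‖ / 2) ≤ κ (2 * ξ + τ) * (κ (2 * ξ + τ) / 2) :=
          mul_le_mul h1 (by linarith) (by positivity) (hκ0 _ hy)
      _ = 1 / 2 * (κ (2 * ξ + τ) ^ 2 * 1 * 1) := by ring
      _ ≤ 1 / 2 * (κ (2 * ξ + τ) ^ 2 * (1 + |2 * ξ + τ|) * W (2 * ξ + τ)) := by gcongr

theorem exists_goursatP_fixed {k : ℝ → ℂ} (hk : Continuous k) :
    ∃ P : ℝ → ℝ → ℂ, Continuous (Function.uncurry P) ∧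
      ∀ x τ, 0 ≤ x → 0 ≤ τ → P x τ = goursatP k P x τ := by
  obtain ⟨W, hWc, hW0, hdiff, hzero⟩ := exists_weight hk
  let Pu : (ℝ × ℝ →ᵇ ℂ) → ℝ → ℝ → ℂ := fun u x τ => W (2 * x + τ) * u (x, τ)
  have hPuc : ∀ u, Continuous (Function.uncurry (Pu u)) := by
    intro u
    have h1 : Continuous fun z : ℝ × ℝ => (W (2 * z.1 + z.2) : ℂ) :=
      Complex.continuous_ofReal.comp (hWc.comp (by fun_prop))
    exact h1.mul u.continuous
  have hPud : ∀ u v x τ, ‖Pu u x τ - Pu v x τ‖ ≤ dist u v * W (2 * x + τ) := by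
    intro u v x τ
    simp only [Pu, ← mul_sub, norm_mul, Complex.norm_real, Real.norm_eq_abs, abs_of_pos (hW0 _)]
    rw [mul_comm, ← dist_eq_norm]
    exact mul_le_mul_of_nonneg_right (dist_coe_le_dist _) (hW0 _).le
  have hbd : ∀ u x τ, 0 ≤ x → 0 ≤ τ →
      ‖goursatP k (Pu u) x τ‖ ≤ (‖u‖ / 4 + 1 / 4) * W (2 * x + τ) := by
    intro u x τ hx hτ
    have h1 := hdiff _ (fun _ _ => 0) (hPuc u) continuous_const ‖u‖ (norm_nonneg _)
      (fun x τ _ _ => by simpa [Pu] using hPud u 0 x τ) x τ hx hτ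
    calc ‖goursatP k (Pu u) x τ‖ ≤ ‖goursatP k (Pu u) x τ - goursatP k (fun _ _ => 0) x τ‖
          + ‖goursatP k (fun _ _ => 0) x τ‖ := by
            simpa using norm_add_le (goursatP k (Pu u) x τ - goursatP k (fun _ _ => 0) x τ)
              (goursatP k (fun _ _ => 0) x τ)
      _ ≤ _ := by linarith [hzero x τ hx hτ]
  -- The unknown is `u = P / W`. Clamping both coordinates at `0` gives a self-map of bounded
  -- continuous functions on the whole plane, though the estimates hold on the quarter-plane only.
  have hex : ∀ u : ℝ × ℝ →ᵇ ℂ, ∃ v : ℝ × ℝ →ᵇ ℂ, ∀ z, v z =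
      goursatP k (Pu u) (max z.1 0) (max z.2 0) / W (2 * max z.1 0 + max z.2 0) := fun u =>
    ⟨BoundedContinuousFunction.ofNormedAddCommGroup
      (fun z => goursatP k (Pu u) (max z.1 0) (max z.2 0) / W (2 * max z.1 0 + max z.2 0))
      (by
        have h1 := (continuous_goursatP hk (hPuc u)).comp
          (by fun_prop : Continuous fun z : ℝ × ℝ => (max z.1 0, max z.2 0))
        have h2 : Continuous fun z : ℝ × ℝ => (W (2 * max z.1 0 + max z.2 0) : ℂ) :=
          Complex.continuous_ofReal.comp (hWc.comp (by fun_prop))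
        exact h1.div h2 fun z => by exact_mod_cast (hW0 _).ne')
      (‖u‖ / 4 + 1 / 4)
      (fun z => by
        rw [norm_div, Complex.norm_real, Real.norm_eq_abs, abs_of_pos (hW0 _),
          div_le_iff₀ (hW0 _)]
        exact hbd u _ _ (le_max_right _ _) (le_max_right _ _)), fun z => rfl⟩
  choose T hTz using hex
  have hT : ContractingWith (1 / 4) T := by
    refine ⟨by rw [← NNReal.coe_lt_coe]; norm_num, LipschitzWith.of_dist_le_mul fun u v => ?_⟩
    refine (dist_le (by positivity)).2 fun z => ?_
    rw [hTz, hTz, dist_eq_norm, ← sub_div, norm_div, Complex.norm_real, Real.norm_eq_abs,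
      abs_of_pos (hW0 _), div_le_iff₀ (hW0 _)]
    refine (hdiff _ _ (hPuc u) (hPuc v) (dist u v) dist_nonneg (fun x τ _ _ => hPud u v x τ) _ _
      (le_max_right _ _) (le_max_right _ _)).trans_eq ?_
    push_cast
    ring
  obtain ⟨u, hu⟩ : ∃ u, T u = u := ⟨_, hT.fixedPoint_isFixedPt⟩
  refine ⟨Pu u, hPuc u, fun x τ hx hτ => ?_⟩
  have h1 := hTz u (x, τ)
  simp only [hu, max_eq_left hx, max_eq_left hτ] at h1
  have h3 : (W (2 * x + τ) : ℂ) ≠ 0 := Complex.ofReal_ne_zero.2 (hW0 _).ne'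
  rw [eq_div_iff h3] at h1
  rw [← h1]
  exact mul_comm _ _

end

/-! ### Integrating the characteristic equations in the delay `τ`. -/

/-- Fubini's theorem on a triangle. -/
theorem integral_integral_triangle {F : ℝ → ℝ → ℂ} (hF : Continuous (Function.uncurry F))
    {a b : ℝ} (hab : a ≤ b) :
    ∫ s in a..b, ∫ η in a..s, F η s = ∫ η in a..b, ∫ s in η..b, F η s := by
  have h1 : ∀ s ∈ Ioc a b, ∫ η in a..s, F η s
      = ∫ η in Ioc a b, (indicator {z : ℝ × ℝ | z.1 ≤ z.2} (Function.uncurry F)) (η, s) := by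
    intro s hs
    have : ∀ η, (indicator {z : ℝ × ℝ | z.1 ≤ z.2} (Function.uncurry F)) (η, s)
        = (Iic s).indicator (fun η => F η s) η := fun η => by
      simp [indicator, Function.uncurry]
    simp only [this]
    rw [MeasureTheory.setIntegral_indicator measurableSet_Iic, Ioc_inter_Iic,
      min_eq_right hs.2, intervalIntegral.integral_of_le hs.1.le]
  have h2 : ∀ η ∈ Ioc a b, ∫ s in η..b, F η s
      = ∫ s in Ioc a b, (indicator {z : ℝ × ℝ | z.1 ≤ z.2} (Function.uncurry F)) (η, s) := by
    intro η hη
    have : ∀ s, (indicator {z : ℝ × ℝ | z.1 ≤ z.2} (Function.uncurry F)) (η, s)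
        = (Ici η).indicator (fun s => F η s) s := fun s => by
      simp [indicator, Function.uncurry]
    simp only [this]
    have h3 : Ioc a b ∩ Ici η = Icc η b := by
      ext s; simp only [mem_inter_iff, mem_Ioc, mem_Ici, mem_Icc]
      exact ⟨fun h => ⟨h.2, h.1.2⟩, fun h => ⟨⟨hη.1.trans_le h.1, h.2⟩, h.1⟩⟩
    rw [MeasureTheory.setIntegral_indicator measurableSet_Ici, h3,
      intervalIntegral.integral_of_le hη.2, MeasureTheory.integral_Icc_eq_integral_Ioc]
  rw [intervalIntegral.integral_of_le hab, intervalIntegral.integral_of_le hab,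
    MeasureTheory.setIntegral_congr_fun measurableSet_Ioc h1,
    MeasureTheory.setIntegral_congr_fun measurableSet_Ioc h2]
  symm
  apply MeasureTheory.integral_integral_swap
  have hint : MeasureTheory.IntegrableOn (Function.uncurry F) (Ioc a b ×ˢ Ioc a b)
      (MeasureTheory.volume.prod MeasureTheory.volume) :=
    (hF.continuousOn.integrableOn_compact (isCompact_Icc.prod isCompact_Icc)).mono_set
      (prod_mono Ioc_subset_Icc_self Ioc_subset_Icc_self)
  rw [MeasureTheory.IntegrableOn, ← MeasureTheory.Measure.prod_restrict] at hint
  exact hint.indicator (measurableSet_le measurable_fst measurable_snd)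

/-- The primitive in the second variable, vanishing for negative arguments. -/
def primitive (φ : ℝ → ℝ → ℂ) (x τ : ℝ) : ℂ := ∫ s in (0 : ℝ)..(max τ 0), φ x s

theorem continuous_primitive {φ : ℝ → ℝ → ℂ} (hφ : Continuous (Function.uncurry φ)) :
    Continuous (Function.uncurry (primitive φ)) := by
  refine continuous_integral_of_continuous (f := fun (z : ℝ × ℝ) s => φ z.1 s) ?_
    continuous_const (by fun_prop)
  exact hφ.comp (by fun_prop : Continuous fun w : (ℝ × ℝ) × ℝ => (w.1.1, w.2))

theorem primitive_of_nonpos (φ : ℝ → ℝ → ℂ) (x : ℝ) {τ : ℝ} (hτ : τ ≤ 0) :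
    primitive φ x τ = 0 := by
  simp [primitive, max_eq_right hτ]

theorem primitive_of_nonneg (φ : ℝ → ℝ → ℂ) (x : ℝ) {τ : ℝ} (hτ : 0 ≤ τ) :
    primitive φ x τ = ∫ s in (0 : ℝ)..τ, φ x s := by
  rw [primitive, max_eq_left hτ]

theorem primitive_congr {φ φ' : ℝ → ℝ → ℂ} {x x' : ℝ} (h : ∀ s, 0 ≤ s → φ x s = φ' x' s)
    (τ : ℝ) : primitive φ x τ = primitive φ' x' τ := by
  refine intervalIntegral.integral_congr fun s hs => h s ?_
  rw [uIcc_of_le (le_max_right _ _)] at hs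
  exact hs.1

theorem hasDerivAt_primitive_of_pos {φ : ℝ → ℝ → ℂ} (hφ : Continuous (Function.uncurry φ))
    (x : ℝ) {τ : ℝ} (hτ : 0 < τ) : HasDerivAt (primitive φ x) (φ x τ) τ := by
  have hc : Continuous (φ x) := hφ.comp (by fun_prop : Continuous fun s : ℝ => (x, s))
  have h := intervalIntegral.integral_hasDerivAt_right (hc.intervalIntegrable 0 τ)
    (hc.stronglyMeasurableAtFilter _ _) hc.continuousAt
  refine h.congr_of_eventuallyEq ?_
  filter_upwards [lt_mem_nhds hτ] with s hs
  exact primitive_of_nonneg _ _ hs.le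

/-- When the integrand already vanishes for negative arguments, the truncation changes nothing, so
there is no corner at `τ = 0`. -/
theorem hasDerivAt_primitive {φ : ℝ → ℝ → ℂ} (hφ : Continuous (Function.uncurry φ))
    (x : ℝ) (h0 : ∀ s ≤ 0, φ x s = 0) (τ : ℝ) : HasDerivAt (primitive φ x) (φ x τ) τ := by
  have hc : Continuous (φ x) := hφ.comp (by fun_prop : Continuous fun s : ℝ => (x, s))
  have h := intervalIntegral.integral_hasDerivAt_right (hc.intervalIntegrable 0 τ)
    (hc.stronglyMeasurableAtFilter _ _) hc.continuousAt
  have he : primitive φ x = fun τ => ∫ s in (0 : ℝ)..τ, φ x s := by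
    funext s
    rcases le_total 0 s with hs | hs
    · exact primitive_of_nonneg _ _ hs
    · rw [primitive_of_nonpos _ _ hs, eq_comm]
      refine intervalIntegral.integral_zero_ae (Filter.Eventually.of_forall fun u hu => h0 u ?_)
      rw [uIoc_of_ge hs] at hu
      exact hu.2
  rw [he]
  exact h

theorem primitive_forward {k : ℝ → ℂ} (hk : Continuous k) {a b : ℝ → ℝ → ℂ}
    (hb : Continuous (Function.uncurry b))
    (h : ∀ x τ, 0 ≤ x → 0 ≤ τ → a x τ = a 0 τ + ∫ ξ in (0 : ℝ)..x, k ξ * b ξ τ)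
    (ha0 : Continuous (a 0)) {x : ℝ} (hx : 0 ≤ x) (τ : ℝ) :
    primitive a x τ = primitive a 0 τ + ∫ ξ in (0 : ℝ)..x, k ξ * primitive b ξ τ := by
  have hF : Continuous (Function.uncurry fun s ξ => k ξ * b ξ s) :=
    (hk.comp continuous_snd).mul (hb.comp continuous_swap)
  have hI : Continuous fun s => ∫ ξ in (0 : ℝ)..x, k ξ * b ξ s :=
    continuous_integral_of_continuous hF continuous_const continuous_const
  have h1 : primitive a x τ
      = ∫ s in (0 : ℝ)..(max τ 0), (a 0 s + ∫ ξ in (0 : ℝ)..x, k ξ * b ξ s) := by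
    refine intervalIntegral.integral_congr fun s hs => h x s hx ?_
    rw [uIcc_of_le (le_max_right _ _)] at hs
    exact hs.1
  rw [h1, intervalIntegral.integral_add (ha0.intervalIntegrable _ _)
    (hI.intervalIntegrable _ _), primitive]
  congr 1
  simp only [primitive, ← intervalIntegral.integral_const_mul]
  rw [intervalIntegral.integral_of_le (le_max_right τ 0), intervalIntegral.integral_of_le hx]
  simp only [intervalIntegral.integral_of_le (le_max_right τ 0),
    intervalIntegral.integral_of_le hx]
  apply MeasureTheory.integral_integral_swap
  rw [MeasureTheory.Measure.prod_restrict]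
  exact (hF.continuousOn.integrableOn_compact (isCompact_Icc.prod isCompact_Icc)).mono_set
    (prod_mono Ioc_subset_Icc_self Ioc_subset_Icc_self)

/-- The substitution `u = x + s / 2` makes the domain a triangle. After the swap, the factor `2`
from `ds = 2 du` cancels the `1/2` from rescaling the inner variable. -/
theorem primitive_characteristic {c : ℝ → ℂ} (hc : Continuous c) {a : ℝ → ℝ → ℂ}
    (ha : Continuous (Function.uncurry a)) (x : ℝ) {τ : ℝ} (hτ : 0 ≤ τ) :
    ∫ s in (0 : ℝ)..τ, ∫ η in x..(x + s / 2), c η * a η (2 * x + s - 2 * η)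
      = ∫ η in x..(x + τ / 2), c η * primitive a η (2 * x + τ - 2 * η) := by
  have hF : Continuous (Function.uncurry fun η s => c η * a η (2 * s - 2 * η)) :=
    (hc.comp continuous_fst).mul
      (ha.comp (by fun_prop : Continuous fun w : ℝ × ℝ => (w.1, 2 * w.2 - 2 * w.1)))
  have h1 : ∀ s : ℝ, ∫ η in x..(x + s / 2), c η * a η (2 * x + s - 2 * η)
      = (fun u => ∫ η in x..u, c η * a η (2 * u - 2 * η)) (x + s / 2) := fun s => by
    rw [show 2 * x + s = 2 * (x + s / 2) by ring]
  simp only [h1]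
  rw [intervalIntegral.integral_comp_add_div
    (fun u => ∫ η in x..u, c η * a η (2 * u - 2 * η)) two_ne_zero x, zero_div, add_zero,
    integral_integral_triangle hF (by linarith), ← intervalIntegral.integral_smul]
  refine intervalIntegral.integral_congr fun η hη => ?_
  rw [uIcc_of_le (by linarith)] at hη
  simp only [intervalIntegral.integral_const_mul]
  rw [primitive_of_nonneg _ _ (by linarith [hη.2]),
    intervalIntegral.integral_comp_mul_sub (fun u => a η u) two_ne_zero (2 * η), sub_self,
    show 2 * (x + τ / 2) - 2 * η = 2 * x + τ - 2 * η by ring, mul_smul_comm, smul_smul]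
  norm_num

theorem primitive_backward {c : ℝ → ℂ} (hc : Continuous c) {a b : ℝ → ℝ → ℂ}
    (ha : Continuous (Function.uncurry a))
    (h : ∀ x τ, 0 ≤ x → 0 ≤ τ →
      b x τ = -∫ η in x..(x + τ / 2), c η * a η (2 * x + τ - 2 * η))
    {x : ℝ} (hx : 0 ≤ x) (τ : ℝ) :
    primitive b x τ = -∫ η in x..(x + τ / 2), c η * primitive a η (2 * x + τ - 2 * η) := by
  rcases le_total 0 τ with hτ | hτ
  · rw [← primitive_characteristic hc ha x hτ, primitive_of_nonneg _ _ hτ,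
      ← intervalIntegral.integral_neg]
    refine intervalIntegral.integral_congr fun s hs => h x s hx ?_
    rw [uIcc_of_le hτ] at hs
    exact hs.1
  -- For negative `τ` the interval is reversed, and on it `2x + τ - 2η` is negative, so the
  -- truncated primitive vanishes.
  · rw [primitive_of_nonpos _ _ hτ, eq_comm, neg_eq_zero]
    refine intervalIntegral.integral_zero_ae (Filter.Eventually.of_forall fun u hu => ?_)
    rw [uIoc_of_ge (by linarith)] at hu
    rw [primitive_of_nonpos _ _ (by linarith [hu.1]), mul_zero]

theorem hasFDerivAt_of_partial {F F₁ F₂ : ℝ → ℝ → ℂ} (h₁ : Continuous (Function.uncurry F₁))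
    (h₂ : Continuous (Function.uncurry F₂))
    (d₁ : ∀ x c, 0 < x → HasDerivAt (fun x => F x c) (F₁ x c) x)
    (d₂ : ∀ x c, 0 < x → HasDerivAt (F x) (F₂ x c) c) {z : ℝ × ℝ} (hz : 0 < z.1) :
    HasFDerivAt (Function.uncurry F)
      ((ContinuousLinearMap.toSpanSingleton ℝ (F₁ z.1 z.2)).coprod
        (ContinuousLinearMap.toSpanSingleton ℝ (F₂ z.1 z.2))) z := by
  have hev : ∀ᶠ v : ℝ × ℝ in nhds z, 0 < v.1 :=
    continuous_fst.continuousAt.eventually (lt_mem_nhds hz)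
  have hs : ∀ {G : ℝ → ℝ → ℂ}, Continuous (Function.uncurry G) → Continuous
      (Function.uncurry fun x c => ContinuousLinearMap.toSpanSingleton ℝ (G x c)) := fun hG =>
    (ContinuousLinearMap.toSpanSingletonCLE (𝕜 := ℝ) (E := ℂ)).continuous.comp hG
  exact (hasStrictFDerivAt_uncurry_coprod (𝕜 := ℝ)
    (f₁ := fun x c => ContinuousLinearMap.toSpanSingleton ℝ (F₁ x c))
    (f₂ := fun x c => ContinuousLinearMap.toSpanSingleton ℝ (F₂ x c))
    (hev.mono fun v hv => (d₁ v.1 v.2 hv).hasFDerivAt)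
    (hev.mono fun v hv => (d₂ v.1 v.2 hv).hasFDerivAt)
    (hs h₁).continuousAt (hs h₂).continuousAt).hasFDerivAt

theorem contDiffOn_of_partial {F F₁ F₂ : ℝ → ℝ → ℂ} (h₁ : Continuous (Function.uncurry F₁))
    (h₂ : Continuous (Function.uncurry F₂))
    (d₁ : ∀ x c, 0 < x → HasDerivAt (fun x => F x c) (F₁ x c) x)
    (d₂ : ∀ x c, 0 < x → HasDerivAt (F x) (F₂ x c) c) :
    ContDiffOn ℝ 1 (Function.uncurry F) (Ioi 0 ×ˢ univ) := by
  have ho : IsOpen (Ioi (0 : ℝ) ×ˢ (univ : Set ℝ)) := isOpen_Ioi.prod isOpen_univ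
  refine (contDiffOn_succ_iff_hasFDerivWithinAt_of_uniqueDiffOn (n := 0) ho.uniqueDiffOn).2
    ⟨by simp, fun z => (ContinuousLinearMap.toSpanSingleton ℝ (F₁ z.1 z.2)).coprod
        (ContinuousLinearMap.toSpanSingleton ℝ (F₂ z.1 z.2)), ?_,
      fun z hz => (hasFDerivAt_of_partial h₁ h₂ d₁ d₂ hz.1).hasFDerivWithinAt⟩
  refine contDiffOn_zero.2 (Continuous.continuousOn ?_)
  have hs : ∀ {G : ℝ → ℝ → ℂ}, Continuous (Function.uncurry G) → Continuous
      fun z : ℝ × ℝ => ContinuousLinearMap.toSpanSingleton ℝ (G z.1 z.2) := fun hG =>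
    (ContinuousLinearMap.toSpanSingletonCLE (𝕜 := ℝ) (E := ℂ)).continuous.comp hG
  exact (ContinuousLinearMap.coprodEquivL ℝ (𝕜 := ℝ) (E := ℝ) (F := ℝ) (G := ℂ)).continuous.comp ((hs h₁).prodMk (hs h₂))

/-! ### From the impulse response to a classical solution. -/

/-- `P` and `Q` are the regular parts of the components of the response to a unit impulse, in the
coordinates `x` and `τ = t - x`. -/
structure IsImpulseResponse (k : ℝ → ℂ) (P Q : ℝ → ℝ → ℂ) : Prop where
  continuous_left : Continuous (Function.uncurry P)
  continuous_right : Continuous (Function.uncurry Q)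
  forward : ∀ x τ, 0 ≤ x → 0 ≤ τ → P x τ = ∫ ξ in (0 : ℝ)..x, k ξ * Q ξ τ
  backward : ∀ x τ, 0 ≤ x → 0 ≤ τ → Q x τ = goursatQ k P x τ

theorem exists_isImpulseResponse {k : ℝ → ℂ} (hk : Continuous k) :
    ∃ P Q, IsImpulseResponse k P Q := by
  obtain ⟨P, hP, h⟩ := exists_goursatP_fixed hk
  exact ⟨P, goursatQ k P, hP, continuous_goursatQ hk hP, h, fun _ _ _ _ => rfl⟩

/-- The first component of the response to a unit step. -/
def stepResponse (P : ℝ → ℝ → ℂ) (x τ : ℝ) : ℂ := 1 + primitive P x τ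

theorem continuous_stepResponse {P : ℝ → ℝ → ℂ} (hP : Continuous (Function.uncurry P)) :
    Continuous (Function.uncurry (stepResponse P)) :=
  continuous_const.add (continuous_primitive hP)

/-- The first component of the response to the control `t ^ 2 / 2`. -/
def fieldA (P : ℝ → ℝ → ℂ) : ℝ → ℝ → ℂ := primitive (primitive (stepResponse P))

/-- The second component of the response to the control `t ^ 2 / 2`. -/
def fieldB (Q : ℝ → ℝ → ℂ) : ℝ → ℝ → ℂ := primitive (primitive (primitive Q))

theorem continuous_fieldA {P : ℝ → ℝ → ℂ} (hP : Continuous (Function.uncurry P)) :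
    Continuous (Function.uncurry (fieldA P)) :=
  continuous_primitive (continuous_primitive (continuous_stepResponse hP))

theorem continuous_fieldB {Q : ℝ → ℝ → ℂ} (hQ : Continuous (Function.uncurry Q)) :
    Continuous (Function.uncurry (fieldB Q)) :=
  continuous_primitive (continuous_primitive (continuous_primitive hQ))

theorem continuous_apply_left {a : ℝ → ℝ → ℂ} (ha : Continuous (Function.uncurry a)) (x : ℝ) :
    Continuous (a x) :=
  ha.comp (by fun_prop : Continuous fun s : ℝ => (x, s))

namespace IsImpulseResponse

variable {k : ℝ → ℂ} {P Q : ℝ → ℝ → ℂ}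

theorem left_zero (h : IsImpulseResponse k P Q) {τ : ℝ} (hτ : 0 ≤ τ) : P 0 τ = 0 := by
  rw [h.forward 0 τ le_rfl hτ, intervalIntegral.integral_same]

theorem fieldA_eq (h : IsImpulseResponse k P Q) (hk : Continuous k) {x : ℝ} (hx : 0 ≤ x)
    (τ : ℝ) : fieldA P x τ = fieldA P 0 τ + ∫ ξ in (0 : ℝ)..x, k ξ * fieldB Q ξ τ := by
  have h0 : ∀ x τ, 0 ≤ x → 0 ≤ τ →
      stepResponse P x τ
        = stepResponse P 0 τ + ∫ ξ in (0 : ℝ)..x, k ξ * primitive Q ξ τ := by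
    intro x τ hx hτ
    rw [stepResponse, primitive_forward hk h.continuous_right (fun x τ hx hτ => by
      rw [h.left_zero hτ, zero_add]; exact h.forward x τ hx hτ)
      (continuous_apply_left h.continuous_left 0) hx, ← add_assoc, stepResponse]
  have hA := continuous_stepResponse h.continuous_left
  have hB := continuous_primitive h.continuous_right
  exact primitive_forward hk (continuous_primitive hB)
    (fun x τ hx _ => primitive_forward hk hB h0 (continuous_apply_left hA 0) hx τ)
    (continuous_apply_left (continuous_primitive hA) 0) hx τ

/-- After one integration the local term `-conj (k (x + s / 2)) / 2` becomes `-∫ conj k`, which is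
exactly what the constant `1` in the step response contributes. From then on the backward equation
is homogeneous and can be integrated again. -/
theorem fieldB_eq (h : IsImpulseResponse k P Q) (hk : Continuous k) {x : ℝ} (hx : 0 ≤ x)
    (τ : ℝ) : fieldB Q x τ
      = -∫ η in x..(x + τ / 2), conj (k η) * fieldA P η (2 * x + τ - 2 * η) := by
  have hc : Continuous fun η => conj (k η) := Complex.continuous_conj.comp hk
  have hP := h.continuous_left
  have h0 : ∀ x τ, 0 ≤ x → 0 ≤ τ → primitive Q x τ
      = -∫ η in x..(x + τ / 2), conj (k η) * stepResponse P η (2 * x + τ - 2 * η) := by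
    intro x τ hx hτ
    have hi1 : Continuous fun s : ℝ => -conj (k (x + s / 2)) / 2 :=
      ((hc.comp (by fun_prop : Continuous fun s : ℝ => x + s / 2)).neg).div_const 2
    have hi2 : Continuous fun s : ℝ =>
        ∫ η in x..(x + s / 2), conj (k η) * P η (2 * x + s - 2 * η) :=
      continuous_integral_of_continuous
        (f := fun s η => conj (k η) * P η (2 * x + s - 2 * η))
        ((hc.comp continuous_snd).mul (hP.comp
          (by fun_prop : Continuous fun w : ℝ × ℝ => (w.2, 2 * x + w.1 - 2 * w.2))))
        (by fun_prop) (by fun_prop)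
    have hi3 : Continuous fun η => conj (k η) * primitive P η (2 * x + τ - 2 * η) :=
      hc.mul ((continuous_primitive hP).comp
        (by fun_prop : Continuous fun η : ℝ => (η, 2 * x + τ - 2 * η)))
    rw [primitive_of_nonneg _ _ hτ, intervalIntegral.integral_congr
      (g := fun s => -conj (k (x + s / 2)) / 2
        - ∫ η in x..(x + s / 2), conj (k η) * P η (2 * x + s - 2 * η))
      (fun s hs => by rw [uIcc_of_le hτ] at hs; exact h.backward x s hx hs.1),
      intervalIntegral.integral_sub (hi1.intervalIntegrable _ _) (hi2.intervalIntegrable _ _),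
      primitive_characteristic hc hP x hτ]
    simp only [stepResponse, mul_add, mul_one]
    rw [intervalIntegral.integral_add (hc.intervalIntegrable _ _) (hi3.intervalIntegrable _ _),
      neg_add, sub_eq_add_neg]
    congr 1
    rw [intervalIntegral.integral_comp_add_div (fun u => -conj (k u) / 2) two_ne_zero x,
      zero_div, add_zero, intervalIntegral.integral_div, intervalIntegral.integral_neg,
      Complex.real_smul]
    push_cast
    ring
  have hA := continuous_stepResponse hP
  exact primitive_backward hc (continuous_primitive hA)
    (fun x τ hx _ => primitive_backward hc hA h0 hx τ) hx τ

theorem hasDerivAt_fieldA_left (h : IsImpulseResponse k P Q) (hk : Continuous k) {x : ℝ}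
    (hx : 0 < x) (τ : ℝ) :
    HasDerivAt (fun x => fieldA P x τ) (k x * fieldB Q x τ) x := by
  have hc : Continuous fun ξ => k ξ * fieldB Q ξ τ := hk.mul
    ((continuous_fieldB h.continuous_right).comp (by fun_prop : Continuous fun ξ : ℝ => (ξ, τ)))
  have hd := (intervalIntegral.integral_hasDerivAt_right (hc.intervalIntegrable 0 x)
    (hc.stronglyMeasurableAtFilter _ _) hc.continuousAt).const_add (fieldA P 0 τ)
  refine hd.congr_of_eventuallyEq ?_
  filter_upwards [lt_mem_nhds hx] with s hs
  exact h.fieldA_eq hk hs.le τ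

theorem hasDerivAt_fieldB_left (h : IsImpulseResponse k P Q) (hk : Continuous k) {x : ℝ}
    (hx : 0 < x) (y : ℝ) :
    HasDerivAt (fun x => fieldB Q x (y - 2 * x)) (conj (k x) * fieldA P x (y - 2 * x)) x := by
  have hc : Continuous fun η => conj (k η) * fieldA P η (y - 2 * η) :=
    (Complex.continuous_conj.comp hk).mul ((continuous_fieldA h.continuous_left).comp
      (by fun_prop : Continuous fun η : ℝ => (η, y - 2 * η)))
  -- With `y = 2x + τ` held fixed, the far endpoint `x + τ / 2 = y / 2` does not move; only the near
  -- endpoint is differentiated.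
  have hd := intervalIntegral.integral_hasDerivAt_right (hc.intervalIntegrable (y / 2) x)
    (hc.stronglyMeasurableAtFilter _ _) hc.continuousAt
  refine hd.congr_of_eventuallyEq ?_
  filter_upwards [lt_mem_nhds hx] with s hs
  rw [h.fieldB_eq hk hs.le, intervalIntegral.integral_symm, neg_neg]
  have e1 : s + (y - 2 * s) / 2 = y / 2 := by ring
  have e2 : ∀ η : ℝ, 2 * s + (y - 2 * s) - 2 * η = y - 2 * η := fun η => by ring
  simp only [e1, e2]

theorem hasDerivAt_fieldA_right (h : IsImpulseResponse k P Q) (x τ : ℝ) :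
    HasDerivAt (fieldA P x) (primitive (stepResponse P) x τ) τ :=
  hasDerivAt_primitive (continuous_primitive (continuous_stepResponse h.continuous_left)) x
    (fun _ hs => primitive_of_nonpos _ _ hs) τ

theorem hasDerivAt_fieldB_right (h : IsImpulseResponse k P Q) (x τ : ℝ) :
    HasDerivAt (fieldB Q x) (primitive (primitive Q) x τ) τ :=
  hasDerivAt_primitive (continuous_primitive (continuous_primitive h.continuous_right)) x
    (fun _ hs => primitive_of_nonpos _ _ hs) τ

end IsImpulseResponse

/-- The solution of the system with boundary control `t ^ 2 / 2 + fieldB Q 0 t`. -/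
def impulseSolution (P Q : ℝ → ℝ → ℂ) (x t : ℝ) : Fin 2 → ℂ :=
  ![fieldA P x (t - x) + fieldB Q x (t - x),
    Complex.I * (fieldA P x (t - x) - fieldB Q x (t - x))]

/-- This fixes the number of integrations: the step response jumps at `0`, its primitive has a
corner there, and the next primitive is the first that is an admissible control. -/
theorem isControl_fieldA_add_fieldB {k : ℝ → ℂ} {P Q : ℝ → ℝ → ℂ}
    (h : IsImpulseResponse k P Q) : IsControl fun t => fieldA P 0 t + fieldB Q 0 t := by
  refine ⟨?_, fun t ht => ?_⟩
  · have hd : ∀ t, HasDerivAt (fun t => fieldA P 0 t + fieldB Q 0 t)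
        (primitive (stepResponse P) 0 t + primitive (primitive Q) 0 t) t := fun t =>
      (h.hasDerivAt_fieldA_right 0 t).add (h.hasDerivAt_fieldB_right 0 t)
    refine contDiff_one_iff_deriv.2 ⟨fun t => (hd t).differentiableAt, ?_⟩
    rw [funext fun t => (hd t).deriv]
    exact (continuous_apply_left (continuous_primitive
      (continuous_stepResponse h.continuous_left)) 0).add
      (continuous_apply_left (continuous_primitive (continuous_primitive h.continuous_right)) 0)
  · simp only [fieldA, fieldB, primitive_of_nonpos _ _ ht, add_zero]

/-- Differentiation and continuous differentiability along sheared coordinates. -/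
theorem sheared_of_partial {F F₁ F₂ : ℝ → ℝ → ℂ} (h₁ : Continuous (Function.uncurry F₁))
    (h₂ : Continuous (Function.uncurry F₂))
    (d₁ : ∀ x c, 0 < x → HasDerivAt (fun x => F x c) (F₁ x c) x)
    (d₂ : ∀ x c, 0 < x → HasDerivAt (F x) (F₂ x c) c) (m : ℝ) :
    ContDiffOn ℝ 1 (fun z : ℝ × ℝ => F z.1 (z.2 + m * z.1)) (Ioi 0 ×ˢ Ioi 0) ∧
    (∀ x t, 0 < x → HasDerivAt (fun t => F x (t + m * x)) (F₂ x (t + m * x)) t) ∧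
    (∀ x t, 0 < x → HasDerivAt (fun x => F x (t + m * x))
      (F₁ x (t + m * x) + m * F₂ x (t + m * x)) x) := by
  refine ⟨?_, fun x t hx => ?_, fun x t hx => ?_⟩
  · refine (contDiffOn_of_partial h₁ h₂ d₁ d₂).comp
      (by fun_prop : ContDiff ℝ 1 fun z : ℝ × ℝ => (z.1, z.2 + m * z.1)).contDiffOn ?_
    exact fun z hz => ⟨hz.1, mem_univ _⟩
  · exact (d₂ x _ hx).comp_add_const t (m * x)
  · have hz : HasDerivAt (fun x : ℝ => (x, t + m * x)) ((1 : ℝ), m) x := by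
      refine (hasDerivAt_id x).prodMk ?_
      simpa using ((hasDerivAt_id x).const_mul m).const_add t
    have := (hasFDerivAt_of_partial h₁ h₂ d₁ d₂ (z := (x, t + m * x)) hx).comp_hasDerivAt x hz
    refine this.congr_deriv ?_
    simp

theorem J_mulVec (u v : ℂ) : J *ᵥ ![u, v] = ![v, -u] := by
  funext i
  change ∑ j, J i j * ![u, v] j = _
  fin_cases i <;> simp [Fin.sum_univ_two, J]

theorem potential_mulVec (p q : ℝ → ℝ) (x : ℝ) (u v : ℂ) :
    potential p q x *ᵥ ![u, v] = ![p x * u + q x * v, q x * u - p x * v] := by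
  funext i
  change ∑ j, potential p q x i j * ![u, v] j = _
  fin_cases i <;> simp [Fin.sum_univ_two, potential, sub_eq_add_neg]

/-- The vectors `(1, i)` and `(1, -i)` diagonalise `J`; in this basis the potential couples the two
waves through `k` and `conj k`. -/
theorem isSolution_impulseSolution {p q : ℝ → ℝ} {k : ℝ → ℂ} {P Q : ℝ → ℝ → ℂ}
    (h : IsImpulseResponse k P Q) (hk : Continuous k)
    (hpq : ∀ x, 0 < x → k x = q x + Complex.I * p x) :
    IsSolution p q (fun t => fieldA P 0 t + fieldB Q 0 t) (impulseSolution P Q) := by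
  have hA := continuous_fieldA h.continuous_left
  have hB := continuous_fieldB h.continuous_right
  have hA1 := continuous_primitive (continuous_stepResponse h.continuous_left)
  have hB1 := continuous_primitive (continuous_primitive h.continuous_right)
  -- Each wave is differentiated in its own characteristic coordinate: `t - x` for the first (shear
  -- `-1`), `t + x` for the second (shear `1`).
  obtain ⟨cA, tA, xA⟩ := sheared_of_partial (F := fieldA P)
    (F₁ := fun x τ => k x * fieldB Q x τ) (F₂ := primitive (stepResponse P))
    ((hk.comp continuous_fst).mul hB) hA1
    (fun x c hx => h.hasDerivAt_fieldA_left hk hx c)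
    (fun x c _ => h.hasDerivAt_fieldA_right x c) (-1)
  obtain ⟨cB, tB, xB⟩ := sheared_of_partial (F := fun x y => fieldB Q x (y - 2 * x))
    (F₁ := fun x y => conj (k x) * fieldA P x (y - 2 * x))
    (F₂ := fun x y => primitive (primitive Q) x (y - 2 * x))
    ((Complex.continuous_conj.comp (hk.comp continuous_fst)).mul
      (hA.comp (by fun_prop : Continuous fun z : ℝ × ℝ => (z.1, z.2 - 2 * z.1))))
    (hB1.comp (by fun_prop : Continuous fun z : ℝ × ℝ => (z.1, z.2 - 2 * z.1)))
    (fun x c hx => h.hasDerivAt_fieldB_left hk hx c)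
    (fun x c _ => (h.hasDerivAt_fieldB_right x _).comp_sub_const c (2 * x)) 1
  have eA : ∀ x t : ℝ, t + -1 * x = t - x := fun x t => by ring
  have eB : ∀ x t : ℝ, t + 1 * x - 2 * x = t - x := fun x t => by ring
  simp only [eA, eB] at cA tA xA cB tB xB
  have hY : Continuous fun z : ℝ × ℝ => impulseSolution P Q z.1 z.2 := by
    have hs : Continuous fun z : ℝ × ℝ => (z.1, z.2 - z.1) := by fun_prop
    have h1 := hA.comp hs
    have h2 := hB.comp hs
    refine continuous_pi fun i => ?_
    fin_cases i
    · exact h1.add h2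
    · exact continuous_const.mul (h1.sub h2)
  refine ⟨hY.continuousOn, ?_, ?_, ?_, ?_⟩
  · refine contDiffOn_pi.2 fun i => ?_
    fin_cases i
    · exact cA.add cB
    · exact contDiffOn_const.mul (cA.sub cB)
  · intro x hx t _
    have ht : HasDerivAt (fun τ => impulseSolution P Q x τ)
        ![primitive (stepResponse P) x (t - x) + primitive (primitive Q) x (t - x),
          Complex.I * (primitive (stepResponse P) x (t - x)
            - primitive (primitive Q) x (t - x))] t := by
      refine hasDerivAt_pi.2 fun i => ?_
      fin_cases i
      · exact (tA x t hx).add (tB x t hx)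
      · exact ((tA x t hx).sub (tB x t hx)).const_mul _
    have hxd : HasDerivAt (fun ξ => impulseSolution P Q ξ t)
        ![k x * fieldB Q x (t - x) + ((-1 : ℝ) : ℂ) * primitive (stepResponse P) x (t - x)
            + (conj (k x) * fieldA P x (t - x)
              + ((1 : ℝ) : ℂ) * primitive (primitive Q) x (t - x)),
          Complex.I * (k x * fieldB Q x (t - x)
            + ((-1 : ℝ) : ℂ) * primitive (stepResponse P) x (t - x)
            - (conj (k x) * fieldA P x (t - x)
              + ((1 : ℝ) : ℂ) * primitive (primitive Q) x (t - x)))] x := by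
      refine hasDerivAt_pi.2 fun i => ?_
      fin_cases i
      · exact (xA x t hx).add (xB x t hx)
      · exact ((xA x t hx).sub (xB x t hx)).const_mul _
    rw [ht.deriv, hxd.deriv]
    have hc : conj (k x) = q x - Complex.I * p x := by
      rw [hpq x hx]; simp [sub_eq_add_neg]
    rw [J_mulVec, impulseSolution, potential_mulVec, hc, hpq x hx]
    have hI := Complex.I_sq
    funext i
    fin_cases i
    · simp
      linear_combination (p x * (fieldA P x (t - x) + fieldB Q x (t - x))) * hI
    · simp
      linear_combination (primitive (stepResponse P) x (t - x)
        - primitive (primitive Q) x (t - x)) * hI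
  · intro x hx
    have hn : 0 - x ≤ 0 := by linarith
    funext i
    fin_cases i <;> simp only [impulseSolution, fieldA, fieldB, primitive_of_nonpos _ _ hn] <;> simp
  · intro t _
    simp [impulseSolution]

/-! ### Matrix exponentials and entrywise differentiation. -/

section MatrixCalculus

open scoped Matrix.Norms.Operator

variable {n : ℕ}

/-- The one-parameter group `exp (c t M)`. -/
def expGroup (c : ℂ) (M : Matrix (Fin n) (Fin n) ℂ) (t : ℝ) : Matrix (Fin n) (Fin n) ℂ :=
  NormedSpace.exp ((c * (t : ℂ)) • M)

theorem expGroup_zero (c : ℂ) (M : Matrix (Fin n) (Fin n) ℂ) : expGroup c M 0 = 1 := by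
  simp [expGroup]

theorem expGroup_add (c : ℂ) (M : Matrix (Fin n) (Fin n) ℂ) (s t : ℝ) :
    expGroup c M (s + t) = expGroup c M s * expGroup c M t := by
  rw [expGroup, expGroup, expGroup, ← Matrix.exp_add_of_commute, ← add_smul]
  · push_cast; ring_nf
  · exact (Commute.refl M).smul_left _ |>.smul_right _

theorem expGroup_neg (c : ℂ) (M : Matrix (Fin n) (Fin n) ℂ) (t : ℝ) :
    expGroup c M (-t) = expGroup (-c) M t := by
  simp [expGroup]

theorem expGroup_mul_neg (c : ℂ) (M : Matrix (Fin n) (Fin n) ℂ) (t : ℝ) :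
    expGroup c M t * expGroup (-c) M t = 1 := by
  rw [← expGroup_neg, ← expGroup_add, add_neg_cancel, expGroup_zero]

theorem expGroup_conjTranspose (c : ℂ) (M : Matrix (Fin n) (Fin n) ℂ) (t : ℝ) :
    (expGroup c M t)ᴴ = expGroup (conj c) Mᴴ t := by
  rw [expGroup, expGroup, ← Matrix.exp_conjTranspose, conjTranspose_smul]
  simp

theorem expGroup_comm (c : ℂ) (M : Matrix (Fin n) (Fin n) ℂ) (t : ℝ) :
    expGroup c M t * M = M * expGroup c M t :=
  (((Commute.refl M).smul_left (c * (t : ℂ))).exp_left).eq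

theorem hasDerivAt_expGroup (c : ℂ) (M : Matrix (Fin n) (Fin n) ℂ) (t : ℝ) :
    HasDerivAt (expGroup c M) (c • (M * expGroup c M t)) t := by
  have h := hasDerivAt_exp_smul_const' (𝕂 := ℝ) (c • M) t
  have e : ∀ t : ℝ, t • c • M = (c * (t : ℂ)) • M := fun t => by
    rw [mul_comm c, mul_smul]; exact (Complex.coe_smul t (c • M)).symm
  simp only [e] at h
  rw [smul_mul_assoc] at h
  exact h

theorem continuous_expGroup (c : ℂ) (M : Matrix (Fin n) (Fin n) ℂ) : Continuous (expGroup c M) :=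
  continuous_iff_continuousAt.2 fun t => (hasDerivAt_expGroup c M t).continuousAt

theorem hasDerivAt_matrix_entry {m l : ℕ} {M : ℝ → Matrix (Fin m) (Fin l) ℂ}
    {M' : Matrix (Fin m) (Fin l) ℂ} {t : ℝ} (h : HasDerivAt M M' t) (i : Fin m) (j : Fin l) :
    HasDerivAt (fun t => M t i j) (M' i j) t :=
  ((Matrix.entryLinearMap ℝ ℂ i j).toContinuousLinearMap.hasFDerivAt (x := M t)).comp_hasDerivAt
    t h

theorem hasDerivAt_matrix_of_entry {m l : ℕ} {M : ℝ → Matrix (Fin m) (Fin l) ℂ}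
    {M' : Matrix (Fin m) (Fin l) ℂ} {t : ℝ}
    (h : ∀ i j, HasDerivAt (fun t => M t i j) (M' i j) t) : HasDerivAt M M' t := by
  have h1 : HasDerivAt (fun t => (fun i j => M t i j : Fin m → Fin l → ℂ))
      (fun i j => M' i j) t := hasDerivAt_pi.2 fun i => hasDerivAt_pi.2 fun j => h i j
  exact ((Matrix.ofLinearEquiv ℝ (m := Fin m) (n := Fin l)
    (α := ℂ)).toLinearMap.toContinuousLinearMap.hasFDerivAt (x := fun i j => M t i j)).comp_hasDerivAt t h1

theorem hasDerivAt_mulVec {M : ℝ → Matrix (Fin n) (Fin n) ℂ} {M' : Matrix (Fin n) (Fin n) ℂ}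
    {v : ℝ → Fin n → ℂ} {v' : Fin n → ℂ} {t : ℝ} (hM : HasDerivAt M M' t)
    (hv : HasDerivAt v v' t) :
    HasDerivAt (fun t => M t *ᵥ v t) (M' *ᵥ v t + M t *ᵥ v') t := by
  refine hasDerivAt_pi.2 fun i => ?_
  have h := HasDerivAt.fun_sum (u := Finset.univ) fun j _ =>
    (hasDerivAt_matrix_entry hM i j).mul (hasDerivAt_pi.1 hv j)
  refine h.congr_deriv ?_
  simp [Matrix.mulVec, dotProduct, Finset.sum_add_distrib]

theorem hasDerivAt_dotProduct (u : Fin n → ℂ) {v : ℝ → Fin n → ℂ} {v' : Fin n → ℂ} {t : ℝ}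
    (hv : HasDerivAt v v' t) : HasDerivAt (fun t => u ⬝ᵥ v t) (u ⬝ᵥ v') t :=
  HasDerivAt.fun_sum fun j _ => (hasDerivAt_pi.1 hv j).const_mul (u j)

end MatrixCalculus

/-! ### The boundary trace of the impulse response from the response function. -/

section Response

open scoped Matrix.Norms.Operator

variable {n : ℕ} {k : ℝ → ℂ} {P Q : ℝ → ℝ → ℂ}

/-- State-space realisation: the group law splits the kernel, so the convolution is a linear output
of a state obeying a first-order equation. -/
theorem dotProduct_expGroup_integral (α : Matrix (Fin n) (Fin n) ℂ) (θ₁ θ₂ : Fin n → ℂ)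
    {f : ℝ → ℂ} (hf : Continuous f) (t : ℝ) :
    star θ₂ ⬝ᵥ (expGroup (-Complex.I) α t *ᵥ
        ∫ s in (0 : ℝ)..t, f s • (expGroup Complex.I α s *ᵥ θ₁))
      = ∫ s in (0 : ℝ)..t, (star θ₂ ⬝ᵥ (expGroup (-Complex.I) α (t - s) *ᵥ θ₁)) * f s := by
  have hc : Continuous fun s => f s • (expGroup Complex.I α s *ᵥ θ₁) :=
    hf.smul ((continuous_expGroup _ _).matrix_mulVec continuous_const)
  let L : (Fin n → ℂ) →L[ℂ] ℂ :=
    LinearMap.toContinuousLinearMap ((dotProductBilin ℂ ℂ (star θ₂)).comp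
      (Matrix.mulVecLin (expGroup (-Complex.I) α t)))
  have hL : ∀ v, L v = star θ₂ ⬝ᵥ (expGroup (-Complex.I) α t *ᵥ v) := fun v => rfl
  rw [← hL, ← ContinuousLinearMap.intervalIntegral_comp_comm L (hc.intervalIntegrable _ _)]
  refine intervalIntegral.integral_congr fun s _ => ?_
  simp only [map_smul]
  rw [hL, smul_eq_mul, mul_comm, mulVec_mulVec, sub_eq_add_neg, expGroup_add, expGroup_neg,
    neg_neg]

theorem hasDerivAt_duhamel (α : Matrix (Fin n) (Fin n) ℂ) (θ₁ : Fin n → ℂ)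
    {f : ℝ → ℂ} (hf : Continuous f) (t : ℝ) :
    HasDerivAt (fun t => expGroup (-Complex.I) α t *ᵥ
        ∫ s in (0 : ℝ)..t, f s • (expGroup Complex.I α s *ᵥ θ₁))
      ((-Complex.I • α) *ᵥ (expGroup (-Complex.I) α t *ᵥ
        ∫ s in (0 : ℝ)..t, f s • (expGroup Complex.I α s *ᵥ θ₁)) + f t • θ₁) t := by
  have hc : Continuous fun s => f s • (expGroup Complex.I α s *ᵥ θ₁) :=
    hf.smul ((continuous_expGroup _ _).matrix_mulVec continuous_const)
  have h := hasDerivAt_mulVec (hasDerivAt_expGroup (-Complex.I) α t)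
    (intervalIntegral.integral_hasDerivAt_right (hc.intervalIntegrable 0 t)
      (hc.stronglyMeasurableAtFilter _ _) hc.continuousAt)
  refine h.congr_deriv ?_
  congr 1
  · rw [mulVec_mulVec, smul_mul_assoc]
  · rw [mulVec_smul, mulVec_mulVec]
    have := expGroup_mul_neg (-Complex.I) α t
    rw [neg_neg] at this
    rw [this, one_mulVec]

/-- A solution of a linear system with constant coefficients on a half-line is given by the
exponential. -/
theorem eq_expGroup_mulVec (c : ℂ) (M : Matrix (Fin n) (Fin n) ℂ) {w : ℝ → Fin n → ℂ}
    (hw : Continuous w) (hd : ∀ t, 0 < t → HasDerivAt w ((c • M) *ᵥ w t) t) {t : ℝ}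
    (ht : 0 ≤ t) : w t = expGroup c M t *ᵥ w 0 := by
  have hz : Continuous fun t => expGroup (-c) M t *ᵥ w t :=
    (continuous_expGroup _ _).matrix_mulVec hw
  have hz' : ∀ t, 0 < t → HasDerivAt (fun t => expGroup (-c) M t *ᵥ w t) 0 t := by
    intro t ht
    refine (hasDerivAt_mulVec (hasDerivAt_expGroup (-c) M t) (hd t ht)).congr_deriv ?_
    rw [mulVec_mulVec, mul_smul_comm, expGroup_comm, ← add_mulVec, neg_smul, neg_add_cancel,
      zero_mulVec]
  have hconst : ∀ t, 0 ≤ t → expGroup (-c) M t *ᵥ w t = w 0 := by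
    intro t ht
    have h := intervalIntegral.integral_eq_sub_of_hasDerivAt_of_le ht hz.continuousOn
      (fun s hs => hz' s hs.1) intervalIntegrable_const
    rw [intervalIntegral.integral_zero, expGroup_zero, one_mulVec] at h
    exact sub_eq_zero.1 h.symm
  rw [← hconst t ht, mulVec_mulVec, expGroup_mul_neg, one_mulVec]

theorem dotProduct_deriv_eq (u : Fin n → ℂ) {w w' : ℝ → Fin n → ℂ} {β β' : ℝ → ℂ}
    (h : ∀ t, 0 < t → β t = u ⬝ᵥ w t) (hw : ∀ t, 0 < t → HasDerivAt w (w' t) t)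
    (hβ : ∀ t, 0 < t → HasDerivAt β (β' t) t) : ∀ t, 0 < t → β' t = u ⬝ᵥ w' t := by
  intro t ht
  refine (hβ t ht).unique ((hasDerivAt_dotProduct u (hw t ht)).congr_of_eventuallyEq ?_)
  filter_upwards [lt_mem_nhds ht] with s hs
  exact h s hs

/-- The state `w` is driven by `(a + b) ϑ₁`, and `b = ϑ₂* w` feeds back, so its generator becomes
`-iM` with drive `a ϑ₁` only. At `x = 0` the drive is `t² / 2`; three differentiations turn `b` into
`Q` and the state into a solution of the homogeneous equation issuing from `ϑ₁`. -/
theorem IsImpulseResponse.right_boundary (h : IsImpulseResponse k P Q)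
    (α : Matrix (Fin n) (Fin n) ℂ) (θ₁ θ₂ : Fin n → ℂ)
    (hβ : ∀ t, 0 ≤ t → fieldB Q 0 t = ∫ s in (0 : ℝ)..t,
      (star θ₂ ⬝ᵥ (expGroup (-Complex.I) α (t - s) *ᵥ θ₁)) * (fieldA P 0 s + fieldB Q 0 s))
    {τ : ℝ} (hτ : 0 ≤ τ) :
    Q 0 τ = star θ₂ ⬝ᵥ
      (expGroup (-Complex.I) (α + Complex.I • vecMulVec θ₁ (star θ₂)) τ *ᵥ θ₁) := by
  set M := α + Complex.I • vecMulVec θ₁ (star θ₂) with hM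
  set B := -Complex.I • M with hB
  have hg0 := continuous_apply_left (continuous_fieldA h.continuous_left) 0
  have hg1 := continuous_apply_left
    (continuous_primitive (continuous_stepResponse h.continuous_left)) 0
  have hf : Continuous fun s => fieldA P 0 s + fieldB Q 0 s :=
    hg0.add (continuous_apply_left (continuous_fieldB h.continuous_right) 0)
  have dg1 : ∀ t, 0 < t → HasDerivAt (primitive (stepResponse P) 0) 1 t := by
    intro t ht
    refine (hasDerivAt_primitive_of_pos (continuous_stepResponse h.continuous_left) 0 ht).congr_deriv
      ?_
    have hz : ∀ s, 0 ≤ s → P 0 s = (fun _ _ => 0 : ℝ → ℝ → ℂ) 0 s := fun s hs => h.left_zero hs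
    rw [stepResponse, primitive_congr (φ := P) (φ' := fun _ _ => 0) (x' := 0) hz]
    simp [primitive]
  obtain ⟨w, hw⟩ : ∃ w : ℝ → Fin n → ℂ, w = fun t => expGroup (-Complex.I) α t *ᵥ
    ∫ s in (0 : ℝ)..t, (fieldA P 0 s + fieldB Q 0 s) • (expGroup Complex.I α s *ᵥ θ₁) := ⟨_, rfl⟩
  have hw0 : w 0 = 0 := by simp [hw]
  have e0 : ∀ t, 0 ≤ t → fieldB Q 0 t = star θ₂ ⬝ᵥ w t := by
    intro t ht
    rw [hw, dotProduct_expGroup_integral α θ₁ θ₂ hf, hβ t ht]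
  have hwd : ∀ t, HasDerivAt w
      ((-Complex.I • α) *ᵥ w t + (fieldA P 0 t + fieldB Q 0 t) • θ₁) t := by
    intro t
    rw [hw]
    exact hasDerivAt_duhamel α θ₁ hf t
  have hwc : Continuous w := continuous_iff_continuousAt.2 fun t => (hwd t).continuousAt
  have d0 : ∀ t, 0 < t → HasDerivAt w (B *ᵥ w t + fieldA P 0 t • θ₁) t := by
    intro t ht
    refine (hwd t).congr_deriv ?_
    rw [hB, hM, smul_add, smul_smul, add_mulVec, e0 t ht.le, smul_mulVec (_ * _),
      vecMulVec_mulVec]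
    simp [add_smul]
    abel
  have hBd : ∀ {v : ℝ → Fin n → ℂ} {v' : Fin n → ℂ} {t : ℝ}, HasDerivAt v v' t →
      HasDerivAt (fun t => B *ᵥ v t) (B *ᵥ v') t := fun hv => by
    simpa using hasDerivAt_mulVec (hasDerivAt_const _ B) hv
  have hBc : ∀ {v : ℝ → Fin n → ℂ}, Continuous v → Continuous fun t => B *ᵥ v t := fun hv =>
    continuous_const.matrix_mulVec hv
  have d1 := fun t ht => (hBd (d0 t ht)).add ((h.hasDerivAt_fieldA_right 0 t).smul_const θ₁)
  have d2 := fun t ht => (hBd (d1 t ht)).add ((dg1 t ht).smul_const θ₁)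
  have d3 := fun t ht => (hBd (d2 t ht)).add_const ((1 : ℂ) • θ₁)
  have e1 := dotProduct_deriv_eq (star θ₂) (fun t ht => e0 t ht.le) d0
    (fun t _ => h.hasDerivAt_fieldB_right 0 t)
  have e2 := dotProduct_deriv_eq (star θ₂) e1 d1
    (fun t _ => hasDerivAt_primitive (continuous_primitive h.continuous_right) 0
      (fun _ hs => primitive_of_nonpos _ _ hs) t)
  have e3 := dotProduct_deriv_eq (star θ₂) e2 d2
    (fun t ht => hasDerivAt_primitive_of_pos h.continuous_right 0 ht)
  -- This is the third derivative of `w` for `t > 0`, in a form continuous on the whole line; its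
  -- value at `0` is `ϑ₁`.
  have c3 : Continuous fun t => B *ᵥ (B *ᵥ (B *ᵥ w t + fieldA P 0 t • θ₁)
      + primitive (stepResponse P) 0 t • θ₁) + (1 : ℂ) • θ₁ :=
    (hBc ((hBc ((hBc hwc).add (hg0.smul continuous_const))).add
      (hg1.smul continuous_const))).add continuous_const
  have hfin := fun t (ht : 0 ≤ t) => eq_expGroup_mulVec (-Complex.I) M c3 d3 ht
  have heq : EqOn (Q 0) (fun t => star θ₂ ⬝ᵥ (expGroup (-Complex.I) M t *ᵥ θ₁)) (Ioi 0) := by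
    intro t ht
    refine (e3 t ht).trans ?_
    refine congrArg _ ((hfin t (le_of_lt ht)).trans ?_)
    simp [hw0, fieldA, primitive_of_nonpos]
  have hcl := heq.closure (continuous_apply_left h.continuous_right 0)
    (continuous_const.dotProduct
      ((continuous_expGroup (-Complex.I) M).matrix_mulVec continuous_const))
  rw [closure_Ioi] at hcl
  exact hcl hτ

end Response

/-! ### The matrix `S(x)`: invertibility, Lyapunov identity, derivatives. -/

section Explicit

open scoped Matrix.Norms.Operator

variable {n : ℕ}

/-- The sesquilinear form `u* M v`. -/
def sesq (u v : Fin n → ℂ) (M : Matrix (Fin n) (Fin n) ℂ) : ℂ := star u ⬝ᵥ (M *ᵥ v)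

theorem sesq_sub (u v : Fin n → ℂ) (M N : Matrix (Fin n) (Fin n) ℂ) :
    sesq u v (M - N) = sesq u v M - sesq u v N := by
  simp [sesq, sub_mulVec]

theorem sesq_smul (u v : Fin n → ℂ) (c : ℂ) (M : Matrix (Fin n) (Fin n) ℂ) :
    sesq u v (c • M) = c * sesq u v M := by
  simp [sesq, smul_mulVec]

theorem sesq_mul_vecMulVec_mul (u v a b : Fin n → ℂ) (M N : Matrix (Fin n) (Fin n) ℂ) :
    sesq u v (M * vecMulVec a (star b) * N) = sesq u a M * sesq b v N := by
  rw [sesq, sesq, sesq, ← mulVec_mulVec, ← mulVec_mulVec, vecMulVec_mulVec]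
  simp [mulVec_smul, mul_comm]

theorem conj_sesq (u v : Fin n → ℂ) (M : Matrix (Fin n) (Fin n) ℂ) :
    conj (sesq u v M) = sesq v u Mᴴ := by
  have h : conj (sesq u v M) = star (star u ⬝ᵥ (M *ᵥ v)) := rfl
  rw [h, sesq, ← star_dotProduct_star, star_star, star_mulVec, ← dotProduct_mulVec]

theorem hasDerivAt_sesq (u v : Fin n → ℂ) {M : ℝ → Matrix (Fin n) (Fin n) ℂ}
    {M' : Matrix (Fin n) (Fin n) ℂ} {t : ℝ} (h : HasDerivAt M M' t) :
    HasDerivAt (fun t => sesq u v (M t)) (sesq u v M') t := by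
  refine (hasDerivAt_dotProduct (star u)
    (hasDerivAt_mulVec h (hasDerivAt_const t v))).congr_deriv ?_
  simp [sesq]

theorem continuous_sesq (u v : Fin n → ℂ) : Continuous (sesq u v) :=
  continuous_const.dotProduct (continuous_id.matrix_mulVec continuous_const)

theorem hasDerivAt_nonsing_inv {M : ℝ → Matrix (Fin n) (Fin n) ℂ}
    {M' : Matrix (Fin n) (Fin n) ℂ} {t : ℝ} (h : HasDerivAt M M' t) (hu : IsUnit (M t)) :
    HasDerivAt (fun t => (M t)⁻¹) (-((M t)⁻¹ * M' * (M t)⁻¹)) t := by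
  obtain ⟨u, hu⟩ := hu
  have h1 := hasFDerivAt_ringInverse (𝕜 := ℝ) u
  rw [hu] at h1
  have h2 := h1.comp_hasDerivAt t h
  have e : (↑u⁻¹ : Matrix (Fin n) (Fin n) ℂ) = (M t)⁻¹ := by
    rw [← hu, coe_units_inv]
  simp only [nonsing_inv_eq_ringInverse] at e ⊢
  refine h2.congr_deriv ?_
  simp [e]

theorem vecMulVec_mulVec_star (M : Matrix (Fin n) (Fin n) ℂ) (θ : Fin n → ℂ) :
    vecMulVec (M *ᵥ θ) (star (M *ᵥ θ)) = M * vecMulVec θ (star θ) * Mᴴ := by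
  rw [star_mulVec, mul_vecMulVec, vecMulVec_mul]

theorem matΛ_mul_conjTranspose (A : Matrix (Fin n) (Fin n) ℂ) (θ₁ θ₂ : Fin n → ℂ) (t : ℝ) :
    matΛ A θ₁ θ₂ t * (matΛ A θ₁ θ₂ t)ᴴ
      = expGroup (-Complex.I) A t * vecMulVec θ₁ (star θ₁) * expGroup Complex.I Aᴴ t
        + expGroup Complex.I A t * vecMulVec θ₂ (star θ₂) * expGroup (-Complex.I) Aᴴ t := by
  have h1 : expGroup Complex.I Aᴴ t = (expGroup (-Complex.I) A t)ᴴ := by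
    rw [expGroup_conjTranspose]; simp
  have h2 : expGroup (-Complex.I) Aᴴ t = (expGroup Complex.I A t)ᴴ := by
    rw [expGroup_conjTranspose]; simp
  rw [h1, h2, ← vecMulVec_mulVec_star, ← vecMulVec_mulVec_star]
  ext i j
  rw [mul_apply, Fin.sum_univ_two]
  simp [matΛ, expGroup, vecMulVec_apply]

theorem continuous_gram (A : Matrix (Fin n) (Fin n) ℂ) (θ₁ θ₂ : Fin n → ℂ) :
    Continuous fun t => matΛ A θ₁ θ₂ t * (matΛ A θ₁ θ₂ t)ᴴ := by
  simp only [matΛ_mul_conjTranspose]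
  have := continuous_expGroup (n := n)
  exact (((this _ _).mul continuous_const).mul (this _ _)).add
    (((this _ _).mul continuous_const).mul (this _ _))

theorem hasDerivAt_matS (A : Matrix (Fin n) (Fin n) ℂ) (θ₁ θ₂ : Fin n → ℂ) (x : ℝ) :
    HasDerivAt (matS A θ₁ θ₂) (matΛ A θ₁ θ₂ x * (matΛ A θ₁ θ₂ x)ᴴ) x := by
  refine (hasDerivAt_matrix_of_entry (M := fun x => Matrix.of fun i j =>
    ∫ t in (0 : ℝ)..x, (matΛ A θ₁ θ₂ t * (matΛ A θ₁ θ₂ t)ᴴ) i j) fun i j => ?_).const_add 1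
  have hc : Continuous fun t => (matΛ A θ₁ θ₂ t * (matΛ A θ₁ θ₂ t)ᴴ) i j :=
    (continuous_gram A θ₁ θ₂).matrix_elem i j
  exact intervalIntegral.integral_hasDerivAt_right (hc.intervalIntegrable _ _)
    (hc.stronglyMeasurableAtFilter _ _) hc.continuousAt

theorem matS_zero (A : Matrix (Fin n) (Fin n) ℂ) (θ₁ θ₂ : Fin n → ℂ) :
    matS A θ₁ θ₂ 0 = 1 := by
  ext i j
  simp [matS]

theorem matS_conjTranspose (A : Matrix (Fin n) (Fin n) ℂ) (θ₁ θ₂ : Fin n → ℂ) (x : ℝ) :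
    (matS A θ₁ θ₂ x)ᴴ = matS A θ₁ θ₂ x := by
  rw [matS, conjTranspose_add, conjTranspose_one]
  congr 1
  ext i j
  rw [conjTranspose_apply, of_apply, of_apply]
  have h : ∀ t, (matΛ A θ₁ θ₂ t * (matΛ A θ₁ θ₂ t)ᴴ) i j
      = conj ((matΛ A θ₁ θ₂ t * (matΛ A θ₁ θ₂ t)ᴴ) j i) := fun t => by
    conv_lhs => rw [← (isHermitian_mul_conjTranspose_self (matΛ A θ₁ θ₂ t)).eq]
    rfl
  simp only [h, intervalIntegral.intervalIntegral_conj]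
  rfl

open scoped ComplexOrder in
-- The quadratic form `v* S(y) v` is nondecreasing, since `S' = Λ Λ*`, and starts at `|v|²`; a
-- vector in the kernel of `S(x)` must therefore vanish.
theorem isUnit_matS (A : Matrix (Fin n) (Fin n) ℂ) (θ₁ θ₂ : Fin n → ℂ) {x : ℝ} (hx : 0 ≤ x) :
    IsUnit (matS A θ₁ θ₂ x) := by
  refine mulVec_injective_iff_isUnit.1
    ((injective_iff_map_eq_zero (matS A θ₁ θ₂ x).mulVecLin).2 fun v hv => ?_)
  have hd : ∀ y, HasDerivAt (fun y => (sesq v v (matS A θ₁ θ₂ y)).re)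
      (sesq v v (matΛ A θ₁ θ₂ y * (matΛ A θ₁ θ₂ y)ᴴ)).re y := fun y =>
    Complex.reCLM.hasFDerivAt.comp_hasDerivAt y (hasDerivAt_sesq v v (hasDerivAt_matS A θ₁ θ₂ y))
  have hmono : Monotone fun y => (sesq v v (matS A θ₁ θ₂ y)).re := by
    refine monotone_of_deriv_nonneg (fun y => (hd y).differentiableAt) fun y => ?_
    rw [(hd y).deriv]
    exact (posSemidef_self_mul_conjTranspose (matΛ A θ₁ θ₂ y)).re_dotProduct_nonneg v
  have h := hmono hx
  have hv' : matS A θ₁ θ₂ x *ᵥ v = 0 := hv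
  simp only [matS_zero, sesq, hv', one_mulVec, dotProduct_zero, Complex.zero_re] at h
  have h0 : (star v ⬝ᵥ v).re = ∑ i, Complex.normSq (v i) := by
    simp [dotProduct, Complex.normSq_apply]
  rw [h0] at h
  have hz := (Finset.sum_eq_zero_iff_of_nonneg fun i _ => Complex.normSq_nonneg (v i)).1
    (h.antisymm (Finset.sum_nonneg fun i _ => Complex.normSq_nonneg (v i)))
  funext i
  exact Complex.normSq_eq_zero.1 (hz i (Finset.mem_univ i))

/-- Both sides have the same derivative, and at `0` the identity is the hypothesis on `A - A*`. -/
theorem lyapunov_matS {A : Matrix (Fin n) (Fin n) ℂ} {θ₁ θ₂ : Fin n → ℂ}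
    (hA : A - Aᴴ = Complex.I • (vecMulVec θ₁ (star θ₁) - vecMulVec θ₂ (star θ₂))) (x : ℝ) :
    (Complex.I • A) * matS A θ₁ θ₂ x + matS A θ₁ θ₂ x * (-Complex.I • Aᴴ)
      = expGroup Complex.I A x * vecMulVec θ₂ (star θ₂) * expGroup (-Complex.I) Aᴴ x
        - expGroup (-Complex.I) A x * vecMulVec θ₁ (star θ₁) * expGroup Complex.I Aᴴ x := by
  have hE := hasDerivAt_expGroup Complex.I A
  have hE' := hasDerivAt_expGroup (-Complex.I) A
  have hF := hasDerivAt_expGroup Complex.I Aᴴ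
  have hF' := hasDerivAt_expGroup (-Complex.I) Aᴴ
  have hS := hasDerivAt_matS A θ₁ θ₂
  simp only [← smul_mul_assoc, matΛ_mul_conjTranspose] at hE hE' hF hF' hS
  have cF : ∀ y, (-Complex.I • Aᴴ) * expGroup Complex.I Aᴴ y
      = expGroup Complex.I Aᴴ y * (-Complex.I • Aᴴ) := fun y => by
    rw [smul_mul_assoc, mul_smul_comm, expGroup_comm]
  have cF' : ∀ y, (-Complex.I • Aᴴ) * expGroup (-Complex.I) Aᴴ y
      = expGroup (-Complex.I) Aᴴ y * (-Complex.I • Aᴴ) := fun y => by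
    rw [smul_mul_assoc, mul_smul_comm, expGroup_comm]
  have e1 : -Complex.I • A = -(Complex.I • A) := neg_smul _ _
  have e2 : Complex.I • Aᴴ = -(-Complex.I • Aᴴ) := by rw [neg_smul, neg_neg]
  have h0 : (Complex.I • A) + (-Complex.I • Aᴴ)
      = vecMulVec θ₂ (star θ₂) - vecMulVec θ₁ (star θ₁) := by
    rw [neg_smul, ← sub_eq_add_neg, ← smul_sub, hA, smul_smul, Complex.I_mul_I, neg_one_smul,
      neg_sub]
  rw [e1] at hE'
  rw [e2] at hF
  generalize Complex.I • A = a at *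
  generalize -Complex.I • Aᴴ = c at *
  have hd : ∀ y, HasDerivAt (fun y => a * matS A θ₁ θ₂ y + matS A θ₁ θ₂ y * c
      - (expGroup Complex.I A y * vecMulVec θ₂ (star θ₂) * expGroup (-Complex.I) Aᴴ y
        - expGroup (-Complex.I) A y * vecMulVec θ₁ (star θ₁) * expGroup Complex.I Aᴴ y)) 0 y := by
    intro y
    refine ((((hS y).const_mul a).add ((hS y).mul_const c)).sub
      ((((hE y).mul_const (vecMulVec θ₂ (star θ₂))).mul (hF' y)).sub
        (((hE' y).mul_const (vecMulVec θ₁ (star θ₁))).mul (hF y)))).congr_deriv ?_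
    have h1 := cF y
    have h2 := cF' y
    rw [neg_mul c, h1, h2]
    noncomm_ring
  have hconst := is_const_of_deriv_eq_zero (fun y => (hd y).differentiableAt)
    (fun y => (hd y).deriv) x 0
  simp only [matS_zero, expGroup_zero, mul_one, one_mul, h0, sub_self] at hconst
  exact sub_eq_zero.1 hconst

/-- The derivatives of the two matrix products behind the explicit kernels. -/
theorem hasDerivAt_dressed {A : Matrix (Fin n) (Fin n) ℂ} {θ₁ θ₂ : Fin n → ℂ}
    (hA : A - Aᴴ = Complex.I • (vecMulVec θ₁ (star θ₁) - vecMulVec θ₂ (star θ₂)))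
    {x : ℝ} (hx : 0 ≤ x) :
    HasDerivAt
      (fun x => expGroup Complex.I Aᴴ x * (matS A θ₁ θ₂ x)⁻¹ * expGroup (-Complex.I) A x)
      (-2 * (expGroup Complex.I Aᴴ x * (matS A θ₁ θ₂ x)⁻¹ * expGroup Complex.I A x
        * vecMulVec θ₂ (star θ₂)
        * (expGroup (-Complex.I) Aᴴ x * (matS A θ₁ θ₂ x)⁻¹ * expGroup (-Complex.I) A x))) x ∧
    HasDerivAt
      (fun x => expGroup (-Complex.I) Aᴴ x * (matS A θ₁ θ₂ x)⁻¹ * expGroup (-Complex.I) A x)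
      (-2 * (expGroup (-Complex.I) Aᴴ x * (matS A θ₁ θ₂ x)⁻¹ * expGroup (-Complex.I) A x
        * (Complex.I • A + vecMulVec θ₁ (star θ₁)
          * (expGroup Complex.I Aᴴ x * (matS A θ₁ θ₂ x)⁻¹ * expGroup (-Complex.I) A x)))) x := by
  have hu := isUnit_matS A θ₁ θ₂ hx
  have hE' := hasDerivAt_expGroup (-Complex.I) A x
  have hF := hasDerivAt_expGroup Complex.I Aᴴ x
  have hF' := hasDerivAt_expGroup (-Complex.I) Aᴴ x
  have hS := hasDerivAt_nonsing_inv (hasDerivAt_matS A θ₁ θ₂ x) hu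
  have hL := lyapunov_matS hA x
  have hdet := (isUnit_iff_isUnit_det _).1 hu
  have i1 := mul_nonsing_inv _ hdet
  have i2 := nonsing_inv_mul _ hdet
  simp only [← smul_mul_assoc, matΛ_mul_conjTranspose] at hE' hF hF' hS
  have cE' : (Complex.I • A) * expGroup (-Complex.I) A x
      = expGroup (-Complex.I) A x * (Complex.I • A) := by
    rw [smul_mul_assoc, mul_smul_comm, expGroup_comm]
  have cF : (-Complex.I • Aᴴ) * expGroup Complex.I Aᴴ x
      = expGroup Complex.I Aᴴ x * (-Complex.I • Aᴴ) := by
    rw [smul_mul_assoc, mul_smul_comm, expGroup_comm]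
  have cF' : (-Complex.I • Aᴴ) * expGroup (-Complex.I) Aᴴ x
      = expGroup (-Complex.I) Aᴴ x * (-Complex.I • Aᴴ) := by
    rw [smul_mul_assoc, mul_smul_comm, expGroup_comm]
  have e1 : -Complex.I • A = -(Complex.I • A) := neg_smul _ _
  have e2 : Complex.I • Aᴴ = -(-Complex.I • Aᴴ) := by rw [neg_smul, neg_neg]
  rw [e1] at hE'
  rw [e2] at hF
  generalize Complex.I • A = a at *
  generalize -Complex.I • Aᴴ = c at *
  -- The Lyapunov identity multiplied by `S⁻¹` on both sides carries `-iA*` across `S⁻¹`. Added to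
  -- `-S⁻¹ S' S⁻¹`, it cancels one of the two rank-one terms and doubles the other: `ϑ₂ ϑ₂*`
  -- survives in the first derivative, `ϑ₁ ϑ₁*` in the second.
  have hR : c * (matS A θ₁ θ₂ x)⁻¹ = (matS A θ₁ θ₂ x)⁻¹
      * (expGroup Complex.I A x * vecMulVec θ₂ (star θ₂) * expGroup (-Complex.I) Aᴴ x
        - expGroup (-Complex.I) A x * vecMulVec θ₁ (star θ₁) * expGroup Complex.I Aᴴ x)
      * (matS A θ₁ θ₂ x)⁻¹ - (matS A θ₁ θ₂ x)⁻¹ * a := by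
    rw [← hL, mul_add, add_mul, ← mul_assoc _ (matS A θ₁ θ₂ x) c, i2, one_mul, mul_assoc _ _
      (matS A θ₁ θ₂ x)⁻¹, mul_assoc a, i1, mul_one]
    abel
  refine ⟨((hF.mul hS).mul hE').congr_deriv ?_, ((hF'.mul hS).mul hE').congr_deriv ?_⟩
  · rw [neg_mul c, cF, neg_mul (_ * c), mul_assoc _ c, hR, Pi.mul_apply]
    noncomm_ring
  · rw [cF', mul_assoc _ c, hR, Pi.mul_apply, mul_add (_ * expGroup (-Complex.I) A x),
      mul_assoc _ (expGroup (-Complex.I) A x) a, ← cE']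
    noncomm_ring

end Explicit

/-! ### The closed Volterra system and its uniqueness. -/

/-- The closed nonlinear Volterra system satisfied by an impulse response, the potential being
eliminated through its trace `k x = -2 conj (Q x 0)`. -/
structure IsImpulseKernel (P Q : ℝ → ℝ → ℂ) : Prop where
  continuous_left : Continuous (Function.uncurry P)
  continuous_right : Continuous (Function.uncurry Q)
  forward : ∀ x τ, 0 ≤ x → 0 ≤ τ →
    P x τ = -2 * ∫ ξ in (0 : ℝ)..x, conj (Q ξ 0) * Q ξ τ
  backward : ∀ x τ, 0 ≤ x → 0 ≤ τ →
    Q x τ = Q 0 (2 * x + τ) - 2 * ∫ ξ in (0 : ℝ)..x, Q ξ 0 * P ξ (2 * x + τ - 2 * ξ)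

theorem IsImpulseResponse.trace {k : ℝ → ℂ} {P Q : ℝ → ℝ → ℂ} (h : IsImpulseResponse k P Q)
    {x : ℝ} (hx : 0 ≤ x) : k x = -2 * conj (Q x 0) := by
  rw [h.backward x 0 hx le_rfl, goursatQ]
  simp [Complex.conj_ofNat]
  ring

/-- The backward characteristics of `(x, τ)` and `(0, 2x + τ)` end at the same point, so the local
terms agree and subtraction leaves an integral over `[0, x]`. Thus no value of `k` beyond `x`
remains, except through `Q 0 ·`. -/
theorem IsImpulseResponse.isImpulseKernel {k : ℝ → ℂ} {P Q : ℝ → ℝ → ℂ}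
    (h : IsImpulseResponse k P Q) (hk : Continuous k) : IsImpulseKernel P Q := by
  refine ⟨h.continuous_left, h.continuous_right, fun x τ hx hτ => ?_, fun x τ hx hτ => ?_⟩
  · rw [h.forward x τ hx hτ, ← intervalIntegral.integral_const_mul]
    refine intervalIntegral.integral_congr fun ξ hξ => ?_
    rw [uIcc_of_le hx] at hξ
    simp only [h.trace hξ.1, mul_assoc]
  · have hc : Continuous fun η => conj (k η) * P η (2 * x + τ - 2 * η) :=
      (Complex.continuous_conj.comp hk).mul (h.continuous_left.comp
        (by fun_prop : Continuous fun η : ℝ => (η, 2 * x + τ - 2 * η)))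
    have hi : ∀ u v, IntervalIntegrable (fun η => conj (k η) * P η (2 * x + τ - 2 * η))
      MeasureTheory.volume u v := fun u v => hc.intervalIntegrable u v
    have e : ∫ ξ in (0 : ℝ)..x, Q ξ 0 * P ξ (2 * x + τ - 2 * ξ)
        = -1 / 2 * ∫ ξ in (0 : ℝ)..x, conj (k ξ) * P ξ (2 * x + τ - 2 * ξ) := by
      rw [← intervalIntegral.integral_const_mul]
      refine intervalIntegral.integral_congr fun ξ hξ => ?_
      rw [uIcc_of_le hx] at hξ
      simp only [h.trace hξ.1, map_mul, Complex.conj_conj, map_neg, Complex.conj_ofNat]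
      ring
    rw [e, h.backward x τ hx hτ, h.backward 0 (2 * x + τ) le_rfl (by linarith), goursatQ, goursatQ,
      show (0 : ℝ) + (2 * x + τ) / 2 = x + τ / 2 by ring]
    simp only [mul_zero, zero_add]
    linear_combination
      -intervalIntegral.integral_add_adjacent_intervals (hi 0 x) (hi x (x + τ / 2))

/-- Gronwall in weighted form: integrating `exp (c ξ)` gains a factor `1 / c`, which beats the
Lipschitz constant `2M` of the product once `c` is large. -/
theorem norm_integral_mul_sub_le {f g f' g' : ℝ → ℂ} (hf : Continuous f) (hg : Continuous g)
    (hf' : Continuous f') (hg' : Continuous g') {x M D c : ℝ} (hx : 0 ≤ x) (hM : 0 ≤ M)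
    (hc : 0 < c) (hfM : ∀ ξ ∈ Icc 0 x, ‖f ξ‖ ≤ M) (hgM : ∀ ξ ∈ Icc 0 x, ‖g' ξ‖ ≤ M)
    (hfD : ∀ ξ ∈ Icc 0 x, ‖f ξ - f' ξ‖ ≤ D * Real.exp (c * ξ))
    (hgD : ∀ ξ ∈ Icc 0 x, ‖g ξ - g' ξ‖ ≤ D * Real.exp (c * ξ)) :
    ‖(∫ ξ in (0 : ℝ)..x, f ξ * g ξ) - ∫ ξ in (0 : ℝ)..x, f' ξ * g' ξ‖
      ≤ 2 * M / c * (D * Real.exp (c * x)) := by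
  have hD : 0 ≤ D := by
    have := (norm_nonneg _).trans (hfD 0 ⟨le_rfl, hx⟩)
    simpa using this
  have hd : ∀ ξ, HasDerivAt (fun ξ => 2 * M * D / c * Real.exp (c * ξ))
      (2 * M * (D * Real.exp (c * ξ))) ξ := by
    intro ξ
    have h1 : HasDerivAt (fun ξ : ℝ => c * ξ) c ξ := by
      simpa using (hasDerivAt_id ξ).const_mul c
    refine (h1.exp.const_mul (2 * M * D / c)).congr_deriv ?_
    field_simp
  have hi : Continuous fun ξ => 2 * M * (D * Real.exp (c * ξ)) := by fun_prop
  have hsub := intervalIntegral.integral_sub ((hf.mul hg).intervalIntegrable 0 x)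
    ((hf'.mul hg').intervalIntegrable 0 x) (μ := MeasureTheory.volume)
  simp only [Pi.mul_apply] at hsub
  rw [← hsub]
  refine (intervalIntegral.norm_integral_le_of_norm_le hx
    (g := fun ξ => 2 * M * (D * Real.exp (c * ξ)))
    (Filter.Eventually.of_forall fun ξ hξ => ?_) (hi.intervalIntegrable _ _)).trans ?_
  · have hξ' : ξ ∈ Icc 0 x := ⟨hξ.1.le, hξ.2⟩
    have e : f ξ * g ξ - f' ξ * g' ξ = f ξ * (g ξ - g' ξ) + (f ξ - f' ξ) * g' ξ := by ring
    rw [e]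
    refine (norm_add_le _ _).trans ?_
    rw [norm_mul, norm_mul]
    have h1 := mul_le_mul (hfM ξ hξ') (hgD ξ hξ') (norm_nonneg _) hM
    have h2 := mul_le_mul (hfD ξ hξ') (hgM ξ hξ') (norm_nonneg _) (by positivity)
    linarith
  · rw [intervalIntegral.integral_eq_sub_of_hasDerivAt (fun ξ _ => hd ξ)
      (hi.intervalIntegrable _ _)]
    have h0 : 0 ≤ 2 * M * D / c * Real.exp (c * 0) := by positivity
    have e : 2 * M / c * (D * Real.exp (c * x)) = 2 * M * D / c * Real.exp (c * x) := by ring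
    linarith

/-- The impulse response is determined by its trace at the boundary. -/
theorem IsImpulseKernel.unique {P Q P' Q' : ℝ → ℝ → ℂ} (h : IsImpulseKernel P Q)
    (h' : IsImpulseKernel P' Q') (h0 : ∀ τ, 0 ≤ τ → Q 0 τ = Q' 0 τ) {x : ℝ} (hx : 0 ≤ x) :
    Q x 0 = Q' x 0 := by
  -- A compact domain of dependence of `(x, 0)`: it is stable under all evaluations in the two
  -- integrals.
  set D : Set (ℝ × ℝ) := {z | 0 ≤ z.1 ∧ 0 ≤ z.2 ∧ 2 * z.1 + z.2 ≤ 2 * x} with hD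
  have hDc : IsCompact D := by
    refine (isCompact_Icc.prod isCompact_Icc).of_isClosed_subset (s := Icc 0 x ×ˢ Icc 0 (2 * x))
      ?_ ?_
    · exact (isClosed_le continuous_const continuous_fst).inter
        ((isClosed_le continuous_const continuous_snd).inter
          (isClosed_le (by fun_prop : Continuous fun z : ℝ × ℝ => 2 * z.1 + z.2) continuous_const))
    · rintro z ⟨h1, h2, h3⟩
      exact ⟨⟨h1, by linarith⟩, ⟨h2, by linarith⟩⟩
  have hDn : D.Nonempty := ⟨(x, 0), hx, le_rfl, by simp⟩
  have hbd : ∀ {F : ℝ → ℝ → ℂ}, Continuous (Function.uncurry F) →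
      ∃ M, ∀ z ∈ D, ‖F z.1 z.2‖ ≤ M := fun hF =>
    hDc.exists_bound_of_continuousOn hF.continuousOn
  obtain ⟨M₁, hM₁⟩ := hbd h.continuous_right
  obtain ⟨M₂, hM₂⟩ := hbd h'.continuous_left
  obtain ⟨M₃, hM₃⟩ := hbd h'.continuous_right
  set M := max M₁ (max M₂ M₃)
  have hQM : ∀ z ∈ D, ‖Q z.1 z.2‖ ≤ M := fun z hz => (hM₁ z hz).trans (le_max_left _ _)
  have hPM : ∀ z ∈ D, ‖P' z.1 z.2‖ ≤ M := fun z hz =>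
    (hM₂ z hz).trans ((le_max_left _ _).trans (le_max_right _ _))
  have hQM' : ∀ z ∈ D, ‖Q' z.1 z.2‖ ≤ M := fun z hz =>
    (hM₃ z hz).trans ((le_max_right _ _).trans (le_max_right _ _))
  have hM : 0 ≤ M := (norm_nonneg _).trans (hQM _ hDn.some_mem)
  -- Chosen so that `2 * (2 * M / c) ≤ 1 / 2`, the outer `2` being the factor before the integrals.
  set c := 8 * M + 1 with hcdef
  have hc : 0 < c := by positivity
  have hgc : Continuous fun z : ℝ × ℝ =>
      max ‖P z.1 z.2 - P' z.1 z.2‖ ‖Q z.1 z.2 - Q' z.1 z.2‖ * Real.exp (-(c * z.1)) :=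
    ((h.continuous_left.sub h'.continuous_left).norm.max
      (h.continuous_right.sub h'.continuous_right).norm).mul (by fun_prop)
  obtain ⟨z, hz, hmax⟩ := hDc.exists_isMaxOn hDn hgc.continuousOn
  obtain ⟨Δ, hΔ⟩ : ∃ Δ, Δ =
    max ‖P z.1 z.2 - P' z.1 z.2‖ ‖Q z.1 z.2 - Q' z.1 z.2‖ * Real.exp (-(c * z.1)) := ⟨_, rfl⟩
  have hle : ∀ w ∈ D,
      max ‖P w.1 w.2 - P' w.1 w.2‖ ‖Q w.1 w.2 - Q' w.1 w.2‖ ≤ Δ * Real.exp (c * w.1) := by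
    intro w hw
    have h1 : max ‖P w.1 w.2 - P' w.1 w.2‖ ‖Q w.1 w.2 - Q' w.1 w.2‖ * Real.exp (-(c * w.1)) ≤ Δ := by
      rw [hΔ]
      exact hmax hw
    have h2 := mul_le_mul_of_nonneg_right h1 (Real.exp_pos (c * w.1)).le
    simpa [mul_assoc, ← Real.exp_add] using h2
  have hΔ0 : 0 ≤ Δ := by rw [hΔ]; positivity
  have hcM : 2 * (2 * M / c) ≤ 1 / 2 := by
    rw [← mul_div_assoc, div_le_iff₀ hc]
    linarith
  have hstep : ∀ w ∈ D, max ‖P w.1 w.2 - P' w.1 w.2‖ ‖Q w.1 w.2 - Q' w.1 w.2‖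
      ≤ 1 / 2 * (Δ * Real.exp (c * w.1)) := by
    rintro ⟨y, τ⟩ ⟨hy, hτ, hyτ⟩
    simp only at hy hτ hyτ ⊢
    have m0 : ∀ ξ ∈ Icc 0 y, (ξ, (0 : ℝ)) ∈ D := fun ξ hξ =>
      ⟨hξ.1, le_rfl, by simp only; linarith [hξ.2]⟩
    have m1 : ∀ ξ ∈ Icc 0 y, (ξ, τ) ∈ D := fun ξ hξ =>
      ⟨hξ.1, hτ, by simp only; linarith [hξ.2]⟩
    have m2 : ∀ ξ ∈ Icc 0 y, (ξ, 2 * y + τ - 2 * ξ) ∈ D := fun ξ hξ =>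
      ⟨hξ.1, by simp only; linarith [hξ.2], by simp only; linarith⟩
    have cont : ∀ {F : ℝ → ℝ → ℂ}, Continuous (Function.uncurry F) → ∀ {σ : ℝ → ℝ},
      Continuous σ → Continuous fun ξ => F ξ (σ ξ) := fun hF _ hσ =>
        hF.comp (continuous_id.prodMk hσ)
    have hσ : Continuous fun ξ : ℝ => 2 * y + τ - 2 * ξ := by fun_prop
    have hQ := h.continuous_right
    have hQ' := h'.continuous_right
    have hb : 2 * (2 * M / c * (Δ * Real.exp (c * y))) ≤ 1 / 2 * (Δ * Real.exp (c * y)) := by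
      rw [← mul_assoc]
      exact mul_le_mul_of_nonneg_right hcM (by positivity)
    refine max_le ?_ ?_
    · have hb1 := norm_integral_mul_sub_le
        (Complex.continuous_conj.comp (cont hQ (continuous_const (y := (0 : ℝ)))))
        (cont hQ (continuous_const (y := τ)))
        (Complex.continuous_conj.comp (cont hQ' (continuous_const (y := (0 : ℝ)))))
        (cont hQ' (continuous_const (y := τ))) hy hM hc (D := Δ)
        (fun ξ hξ => by simpa using hQM _ (m0 ξ hξ)) (fun ξ hξ => hQM' _ (m1 ξ hξ))
        (fun ξ hξ => by
          simp only [Function.comp, ← map_sub, RCLike.norm_conj]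
          exact (le_max_right _ _).trans (hle _ (m0 ξ hξ)))
        (fun ξ hξ => (le_max_right _ _).trans (hle _ (m1 ξ hξ)))
      rw [h.forward y τ hy hτ, h'.forward y τ hy hτ, ← mul_sub, norm_mul]
      refine le_trans ?_ hb
      simpa using hb1
    · have hb2 := norm_integral_mul_sub_le (cont hQ (continuous_const (y := (0 : ℝ))))
        (cont h.continuous_left hσ) (cont hQ' (continuous_const (y := (0 : ℝ))))
        (cont h'.continuous_left hσ) hy hM hc (D := Δ)
        (fun ξ hξ => hQM _ (m0 ξ hξ)) (fun ξ hξ => hPM _ (m2 ξ hξ))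
        (fun ξ hξ => (le_max_right _ _).trans (hle _ (m0 ξ hξ)))
        (fun ξ hξ => (le_max_left _ _).trans (hle _ (m2 ξ hξ)))
      rw [h.backward y τ hy hτ, h'.backward y τ hy hτ, h0 _ (by linarith), sub_sub_sub_cancel_left,
        ← mul_sub, norm_mul, norm_sub_rev]
      refine le_trans ?_ hb
      simpa using hb2
  -- The weighted difference attains its maximum `Δ` at `z`, where the halved bound gives `Δ ≤ Δ /
  -- 2`.
  have hΔz : Δ ≤ 0 := by
    have h1 := mul_le_mul_of_nonneg_right (hstep z hz) (Real.exp_pos (-(c * z.1))).le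
    rw [← hΔ, mul_assoc, mul_assoc, ← Real.exp_add] at h1
    simp at h1
    linarith
  have hlast := (le_max_right _ _).trans (hle (x, 0) ⟨hx, le_rfl, by simp⟩)
  have h3 : Δ = 0 := hΔz.antisymm hΔ0
  rw [h3, zero_mul] at hlast
  exact sub_eq_zero.1 (norm_le_zero_iff.1 hlast)

/-! ### The explicit solution of the Volterra system. -/

section ExplicitKernel

open scoped Matrix.Norms.Operator

variable {n : ℕ}

/-- Both equations are the fundamental theorem of calculus, since the rank-one factors split each
derivative into a product of scalars. Along the backward characteristic the derivative of `G`
cancels the `a` term of `Z'` and replaces `X` by `X - 1`, which accounts for the term subtracted in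
`P`. -/
theorem isImpulseKernel_of_hasDerivAt {θ₁ θ₂ : Fin n → ℂ} {a : Matrix (Fin n) (Fin n) ℂ}
    {X Y Z G : ℝ → Matrix (Fin n) (Fin n) ℂ} (hX0 : X 0 = 1) (hG0 : G 0 = 1)
    (dX : ∀ x, 0 ≤ x → HasDerivAt X (-2 * (Y x * vecMulVec θ₂ (star θ₂) * Z x)) x)
    (dZ : ∀ x, 0 ≤ x →
      HasDerivAt Z (-2 * (Z x * (a + vecMulVec θ₁ (star θ₁) * X x))) x)
    (dG : ∀ t, HasDerivAt G (-(a + vecMulVec θ₁ (star θ₁)) * G t) t)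
    (hconj : ∀ x, conj (sesq θ₂ θ₁ (Z x)) = sesq θ₁ θ₂ (Y x)) :
    IsImpulseKernel (fun x τ => sesq θ₁ θ₁ (X (max x 0) * G τ) - sesq θ₁ θ₁ (G τ))
      (fun x τ => sesq θ₂ θ₁ (Z (max x 0) * G τ)) := by
  -- The derivatives are given for `x ≥ 0` only; clamping extends continuity to the whole line.
  have hmax : ∀ F : ℝ → Matrix (Fin n) (Fin n) ℂ, (∀ x, 0 ≤ x → ContinuousAt F x) →
      Continuous fun x => F (max x 0) := fun F hF =>
    continuous_iff_continuousAt.2 fun x =>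
      ContinuousAt.comp (f := fun x : ℝ => max x 0) (hF _ (le_max_right _ _))
        (by fun_prop : Continuous fun x : ℝ => max x 0).continuousAt
  have cX := hmax X fun x hx => (dX x hx).continuousAt
  have cZ := hmax Z fun x hx => (dZ x hx).continuousAt
  have cG : Continuous G := continuous_iff_continuousAt.2 fun t => (dG t).continuousAt
  have cP : Continuous (Function.uncurry fun x τ =>
      sesq θ₁ θ₁ (X (max x 0) * G τ) - sesq θ₁ θ₁ (G τ)) :=
    ((continuous_sesq _ _).comp ((cX.comp continuous_fst).mul (cG.comp continuous_snd))).sub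
      ((continuous_sesq _ _).comp (cG.comp continuous_snd))
  have cQ : Continuous (Function.uncurry fun x τ => sesq θ₂ θ₁ (Z (max x 0) * G τ)) :=
    (continuous_sesq _ _).comp ((cZ.comp continuous_fst).mul (cG.comp continuous_snd))
  have hq : ∀ τ, Continuous fun ξ => sesq θ₂ θ₁ (Z (max ξ 0) * G τ) := fun τ =>
    (continuous_sesq _ _).comp (cZ.mul continuous_const)
  refine ⟨cP, cQ, ?_, ?_⟩
  · intro x τ hx _
    have hd : ∀ ξ ∈ uIcc 0 x, HasDerivAt (fun ξ => sesq θ₁ θ₁ (X ξ * G τ))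
        (-2 * (conj (sesq θ₂ θ₁ (Z (max ξ 0) * G 0)) * sesq θ₂ θ₁ (Z (max ξ 0) * G τ))) ξ := by
      intro ξ hξ
      rw [uIcc_of_le hx] at hξ
      refine (hasDerivAt_sesq θ₁ θ₁ ((dX ξ hξ.1).mul_const (G τ))).congr_deriv ?_
      rw [max_eq_left hξ.1, hG0, mul_one, hconj, ← sesq_mul_vecMulVec_mul, ← sesq_smul]
      congr 1
      rw [neg_smul, two_smul]
      noncomm_ring
    have hc : Continuous fun ξ =>
        -2 * (conj (sesq θ₂ θ₁ (Z (max ξ 0) * G 0)) * sesq θ₂ θ₁ (Z (max ξ 0) * G τ)) :=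
      continuous_const.mul ((Complex.continuous_conj.comp (hq 0)).mul (hq τ))
    have hint := intervalIntegral.integral_eq_sub_of_hasDerivAt hd (hc.intervalIntegrable _ _)
    rw [← intervalIntegral.integral_const_mul, hint, max_eq_left hx, hX0, one_mul]
  · intro x τ hx hτ
    have hd : ∀ ξ ∈ uIcc 0 x, HasDerivAt (fun ξ => sesq θ₂ θ₁ (Z ξ * G (2 * x + τ - 2 * ξ)))
        (-2 * (sesq θ₂ θ₁ (Z (max ξ 0) * G 0)
          * (sesq θ₁ θ₁ (X (max ξ 0) * G (2 * x + τ - 2 * ξ))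
            - sesq θ₁ θ₁ (G (2 * x + τ - 2 * ξ))))) ξ := by
      intro ξ hξ
      rw [uIcc_of_le hx] at hξ
      have hlin : HasDerivAt (fun ξ : ℝ => 2 * x + τ - 2 * ξ) (-2) ξ := by
        simpa using ((hasDerivAt_id ξ).const_mul 2).const_sub (2 * x + τ)
      have hGd : HasDerivAt (fun ξ : ℝ => G (2 * x + τ - 2 * ξ)) _ ξ :=
        (dG (2 * x + τ - 2 * ξ)).scomp ξ hlin
      refine (hasDerivAt_sesq θ₂ θ₁ ((dZ ξ hξ.1).mul hGd)).congr_deriv ?_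
      rw [max_eq_left hξ.1, hG0, mul_one, ← sesq_sub, ← sesq_mul_vecMulVec_mul, ← sesq_smul]
      congr 1
      rw [neg_smul, two_smul, neg_smul, two_smul]
      noncomm_ring
    have hσ : Continuous fun ξ : ℝ => 2 * x + τ - 2 * ξ := by fun_prop
    have hGσ : Continuous fun ξ => G (2 * x + τ - 2 * ξ) := cG.comp hσ
    have hPc : Continuous fun ξ => sesq θ₁ θ₁ (X (max ξ 0) * G (2 * x + τ - 2 * ξ))
        - sesq θ₁ θ₁ (G (2 * x + τ - 2 * ξ)) :=
      ((continuous_sesq _ _).comp (cX.mul hGσ)).sub ((continuous_sesq _ _).comp hGσ)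
    have hc : Continuous fun ξ => -2 * (sesq θ₂ θ₁ (Z (max ξ 0) * G 0)
          * (sesq θ₁ θ₁ (X (max ξ 0) * G (2 * x + τ - 2 * ξ))
            - sesq θ₁ θ₁ (G (2 * x + τ - 2 * ξ)))) :=
      continuous_const.mul ((hq 0).mul hPc)
    have hint := intervalIntegral.integral_eq_sub_of_hasDerivAt hd (hc.intervalIntegrable _ _)
    rw [intervalIntegral.integral_const_mul, show 2 * x + τ - 2 * x = τ by ring,
      show 2 * x + τ - 2 * 0 = 2 * x + τ by ring] at hint
    simp only [max_eq_left hx, max_self]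
    linear_combination -hint

theorem exists_explicit_isImpulseKernel {A : Matrix (Fin n) (Fin n) ℂ} {θ₁ θ₂ : Fin n → ℂ}
    (hA : A - Aᴴ = Complex.I • (vecMulVec θ₁ (star θ₁) - vecMulVec θ₂ (star θ₂))) :
    ∃ P Q, IsImpulseKernel P Q ∧
      (∀ τ, Q 0 τ = sesq θ₂ θ₁
        (expGroup (-Complex.I) (A - Complex.I • vecMulVec θ₁ (star θ₁)) τ)) ∧
      ∀ x, 0 ≤ x → conj (Q x 0) = sesq θ₁ θ₂
        (expGroup Complex.I Aᴴ x * (matS A θ₁ θ₂ x)⁻¹ * expGroup Complex.I A x) := by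
  have hZ0 : expGroup (-Complex.I) Aᴴ 0 * (matS A θ₁ θ₂ 0)⁻¹ * expGroup (-Complex.I) A 0 = 1 := by
    simp [expGroup_zero, matS_zero]
  have hX0 : expGroup Complex.I Aᴴ 0 * (matS A θ₁ θ₂ 0)⁻¹ * expGroup (-Complex.I) A 0 = 1 := by
    simp [expGroup_zero, matS_zero]
  have hG0 : expGroup (-Complex.I) (A - Complex.I • vecMulVec θ₁ (star θ₁)) 0 = 1 :=
    expGroup_zero _ _
  -- As `S` is Hermitian, the adjoint merely reverses the order of the factors and conjugates the
  -- exponentials.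
  have hconj : ∀ x, conj (sesq θ₂ θ₁
      (expGroup (-Complex.I) Aᴴ x * (matS A θ₁ θ₂ x)⁻¹ * expGroup (-Complex.I) A x))
      = sesq θ₁ θ₂ (expGroup Complex.I Aᴴ x * (matS A θ₁ θ₂ x)⁻¹ * expGroup Complex.I A x) := by
    intro x
    rw [conj_sesq]
    simp only [conjTranspose_mul, expGroup_conjTranspose, conjTranspose_nonsing_inv,
      matS_conjTranspose, conjTranspose_conjTranspose, map_neg, Complex.conj_I, neg_neg, mul_assoc]
  have dG : ∀ t, HasDerivAt (expGroup (-Complex.I) (A - Complex.I • vecMulVec θ₁ (star θ₁)))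
      (-(Complex.I • A + vecMulVec θ₁ (star θ₁))
        * expGroup (-Complex.I) (A - Complex.I • vecMulVec θ₁ (star θ₁)) t) t := by
    intro t
    refine (hasDerivAt_expGroup _ _ t).congr_deriv ?_
    rw [← smul_mul_assoc, smul_sub, smul_smul, neg_mul, Complex.I_mul_I, neg_neg, one_smul,
      neg_smul, neg_add, sub_eq_add_neg]
  refine ⟨_, _, isImpulseKernel_of_hasDerivAt hX0 hG0
    (fun x hx => (hasDerivAt_dressed hA hx).1) (fun x hx => (hasDerivAt_dressed hA hx).2) dG hconj,
    fun τ => ?_, fun x hx => ?_⟩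
  · simp only [max_self, hZ0, one_mul]
  · simp only [max_eq_left hx, hG0, mul_one]
    exact hconj x

end ExplicitKernel

end DynDirac

end

theorem mainTheorem11 (p q : ℝ → ℝ)
    (hp : ContDiffOn ℝ 1 p (Ici 0)) (hq : ContDiffOn ℝ 1 q (Ici 0))
    (r : ℝ → ℂ) (hr : DynDirac.IsResponseFunction p q r)
    (n : ℕ) (α : Matrix (Fin n) (Fin n) ℂ) (θ₁ θ₂ : Fin n → ℂ)
    (hα : α - αᴴ = -Complex.I • vecMulVec (θ₁ + θ₂) (star (θ₁ + θ₂)))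
    (hrep : ∀ t : ℝ, 0 ≤ t → r t = -2 * Complex.I *
      (star θ₂ ⬝ᵥ (NormedSpace.exp (-(Complex.I * (t : ℂ)) • α) *ᵥ θ₁))) :
    ∀ x : ℝ, 0 ≤ x →
      IsUnit (DynDirac.matS (DynDirac.matA α θ₁ θ₂) θ₁ θ₂ x) ∧
      p x = -(DynDirac.explicitV (DynDirac.matA α θ₁ θ₂) θ₁ θ₂ x).re ∧
      q x = (DynDirac.explicitV (DynDirac.matA α θ₁ θ₂) θ₁ θ₂ x).im := by
  intro x hx
  refine ⟨DynDirac.isUnit_matS _ _ _ hx, ?_⟩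
  have hA : DynDirac.matA α θ₁ θ₂ - (DynDirac.matA α θ₁ θ₂)ᴴ
      = Complex.I • (vecMulVec θ₁ (star θ₁) - vecMulVec θ₂ (star θ₂)) := by
    have hα' : α = αᴴ + -Complex.I • vecMulVec (θ₁ + θ₂) (star (θ₁ + θ₂)) := by
      rw [← hα]; abel
    rw [DynDirac.matA, conjTranspose_add, conjTranspose_smul, conjTranspose_vecMulVec, star_star]
    nth_rewrite 1 [hα']
    simp only [vecMulVec_add, add_vecMulVec, star_add, Complex.star_def, Complex.conj_I]
    module
  -- The generator of the boundary trace is that of the explicit kernel, so the two Volterra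
  -- solutions share their datum.
  have hM : α + Complex.I • vecMulVec θ₁ (star θ₂)
      = DynDirac.matA α θ₁ θ₂ - Complex.I • vecMulVec θ₁ (star θ₁) := by
    rw [DynDirac.matA, star_add, vecMulVec_add]
    module
  have hmax : ∀ {u : ℝ → ℝ}, ContDiffOn ℝ 1 u (Ici 0) → Continuous fun x => u (max x 0) :=
    fun hu => hu.continuousOn.comp_continuous (by fun_prop) fun x => le_max_right x 0
  have hk : Continuous fun x => (q (max x 0) : ℂ) + Complex.I * p (max x 0) :=
    (Complex.continuous_ofReal.comp (hmax hq)).add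
      (continuous_const.mul (Complex.continuous_ofReal.comp (hmax hp)))
  obtain ⟨P, Q, h⟩ := DynDirac.exists_isImpulseResponse hk
  have hY := hr.response _ (DynDirac.isControl_fieldA_add_fieldB h) _
    (DynDirac.isSolution_impulseSolution (p := p) (q := q) h hk
      fun x hx => by rw [max_eq_left hx.le])
  have hβ : ∀ t, 0 ≤ t → DynDirac.fieldB Q 0 t = ∫ s in (0 : ℝ)..t,
      (star θ₂ ⬝ᵥ (DynDirac.expGroup (-Complex.I) α (t - s) *ᵥ θ₁))
        * (DynDirac.fieldA P 0 s + DynDirac.fieldB Q 0 s) := by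
    intro t ht
    have h1 := hY t ht
    have h2 : ∫ s in (0 : ℝ)..t, r (t - s) * (DynDirac.fieldA P 0 s + DynDirac.fieldB Q 0 s)
        = -2 * Complex.I * ∫ s in (0 : ℝ)..t,
          (star θ₂ ⬝ᵥ (DynDirac.expGroup (-Complex.I) α (t - s) *ᵥ θ₁))
            * (DynDirac.fieldA P 0 s + DynDirac.fieldB Q 0 s) := by
      rw [← intervalIntegral.integral_const_mul]
      refine intervalIntegral.integral_congr fun s hs => ?_
      rw [uIcc_of_le ht] at hs
      simp only [hrep (t - s) (by linarith [hs.2]), DynDirac.expGroup, neg_mul, mul_assoc]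
    rw [h2] at h1
    simp only [DynDirac.impulseSolution, sub_zero, cons_val_one, cons_val_fin_one] at h1
    have hI := Complex.I_sq
    -- The response identity reads `i (a - b) = i (a + b) - 2i ρ * (a + b)`; cancelling `2i` leaves
    -- `b = ρ * (a + b)`.
    refine mul_left_cancel₀ (mul_ne_zero (two_ne_zero) Complex.I_ne_zero) ?_
    linear_combination -h1
  obtain ⟨P', Q', hker, hQ0, htr⟩ := DynDirac.exists_explicit_isImpulseKernel hA
  have huniq := (h.isImpulseKernel hk).unique hker
    (fun τ hτ => by rw [hQ0, h.right_boundary α θ₁ θ₂ hβ hτ, hM]; rfl) hx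
  have htrace := h.trace hx
  rw [huniq, htr x hx, max_eq_left hx] at htrace
  -- `v = i k = -p + i q`, from which both formulas are read off.
  have hv : DynDirac.explicitV (DynDirac.matA α θ₁ θ₂) θ₁ θ₂ x
      = Complex.I * (q x + Complex.I * p x) := by
    rw [htrace, DynDirac.explicitV, DynDirac.sesq, DynDirac.expGroup, DynDirac.expGroup]
    ring
  rw [hv]
  simp
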